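/- All graphs are finite, simple and undirected. A graph $G=(V,E)$ is a cocomparability graph if its complement has a transitive orientation. It is domino-free if it has no induced subgraph isomorphic to the domino, the graph with vertices $a,b,c,d,e,f$ and edges $ab,ac,bd,cd,ce,df,ef$. An ordering of $G$ is a bijection $V\to\{1,\dots,n\}$, where $n=|V|$. LexBFS starts with an empty label at every vertex; in step $i=1,\dots,n$ it gives the number $i$ to an unnumbered vertex $v$ with lexicographically largest label and appends the letter $n-i$ to the label of every unnumbered neighbour of $v$. For an ordering $\sigma$, let $\mathrm{LexBFS}^+(G,\sigma)$ be the ordering produced by LexBFS when each tie among unnumbered vertices with largest label (including the choice of the first vertex) is resolved by taking the tied vertex that is rightmost in $\sigma$. A cycle of $\mathrm{LexBFS}^+$ sweeps of length $k\ge 1$ consists of distinct orderings $\sigma_1,\dots,\sigma_k$ with $\sigma_{i+1}=\mathrm{LexBFS}^+(G,\sigma_i)$ for $1\le i<k$ and $\sigma_1=\mathrm{LexBFS}^+(G,\sigma_k)$, and $\mathrm{LexCycle}(G)$ is the maximum length of such a cycle. Theorem. Let $G$ be a domino-free cocomparability graph with at least two vertices. Then every cycle of $\mathrm{LexBFS}^+$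 sweeps of $G$ has length $2$; in particular $\mathrm{LexCycle}(G)=2$. -/

import Mathlib

namespace LexBFSCycle

/-- The domino: the graph on `a, b, c, d, e, f` (here `0, 1, 2, 3, 4, 5`) with edges
`ab, ac, bd, cd, ce, df, ef`. -/
def domino : SimpleGraph (Fin 6) :=
  SimpleGraph.fromEdgeSet {s(0, 1), s(0, 2), s(1, 3), s(2, 3), s(2, 4), s(3, 5), s(4, 5)}

/-- `G` has no induced subgraph isomorphic to the domino. -/
def IsDominoFree {V : Type*} (G : SimpleGraph V) : Prop :=
  IsEmpty (domino ↪g G)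

/-- `G` is a comparability graph: its edges can be oriented transitively, i.e. there is a strict
partial order whose comparable pairs are exactly the adjacent pairs of `G`. -/
def IsComparability {V : Type*} (G : SimpleGraph V) : Prop :=
  ∃ r : V → V → Prop, IsStrictOrder V r ∧ ∀ u v, G.Adj u v ↔ r u v ∨ r v u

/-- `G` is a cocomparability graph: its complement is a comparability graph. -/
def IsCocomparability {V : Type*} (G : SimpleGraph V) : Prop :=
  IsComparability Gᶜ

/-- An ordering `σ` of the vertices; `σ v` is the (zero-based) position of `v`, and
`u` is to the left of `v` when `σ u < σ v`. -/
abbrev VertexOrdering (V : Type*) [Fintype V] : Type _ := V ≃ Fin (Fintype.card V)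

/-- The vertices listed from left to right. -/
def VertexOrdering.toList {V : Type*} [Fintype V] (σ : VertexOrdering V) : List V := List.ofFn σ.symm

theorem VertexOrdering.mem_toList {V : Type*} [Fintype V] (σ : VertexOrdering V) (v : V) : v ∈ σ.toList := by
  rw [VertexOrdering.toList, List.mem_ofFn]
  exact ⟨σ v, σ.symm_apply_apply v⟩

section Sweep

variable {V : Type*} [Fintype V] [DecidableEq V]

/-- The LexBFS label of `w` once exactly the vertices of `visited` have been numbered, in this
order: for each `i = 1, 2, …` such that the `i`-th visited vertex is adjacent to `w`, the letter
`n - i` has been appended to the label. -/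
def lexLabel (G : SimpleGraph V) [DecidableRel G.Adj] (visited : List V) (w : V) : List ℕ :=
  (visited.zipIdx 1).filterMap fun p =>
    if G.Adj p.1 w then some (Fintype.card V - p.2) else none

/-- The vertex chosen after `visited` by LexBFS with the `+` rule: among the unnumbered vertices
with lexicographically largest label, the rightmost one in `σ`.
(`List.argmax` returns the first maximizer in the list, and the list is traversed from right to
left; the order on `List ℕ` is the lexicographic one.) -/
def nextVertex (G : SimpleGraph V) [DecidableRel G.Adj] (σ : VertexOrdering V) (visited : List V) :
    Option V :=
  (σ.toList.reverse.filter fun v => v ∉ visited).argmax (lexLabel G visited)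

/-- The list of the first `i` vertices numbered by the sweep `LexBFS⁺(G, σ)`. -/
def sweepPrefix (G : SimpleGraph V) [DecidableRel G.Adj] (σ : VertexOrdering V) : ℕ → List V
  | 0 => []
  | i + 1 => sweepPrefix G σ i ++ (nextVertex G σ (sweepPrefix G σ i)).toList

theorem sweepPrefix_nodup (G : SimpleGraph V) [DecidableRel G.Adj] (σ : VertexOrdering V) (i : ℕ) :
    (sweepPrefix G σ i).Nodup := by
  induction i with
  | zero => simp [sweepPrefix]
  | succ i ih =>
    rw [sweepPrefix]
    cases h : nextVertex G σ (sweepPrefix G σ i) with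
    | none => simpa using ih
    | some v =>
      have hv := List.argmax_mem (show v ∈ _ from h)
      simp only [List.mem_filter, decide_eq_true_eq] at hv
      rw [Option.toList_some, ← List.concat_eq_append]
      exact ih.concat hv.2

theorem sweepPrefix_length (G : SimpleGraph V) [DecidableRel G.Adj] (σ : VertexOrdering V) (i : ℕ)
    (hi : i ≤ Fintype.card V) : (sweepPrefix G σ i).length = i := by
  induction i with
  | zero => simp [sweepPrefix]
  | succ i ih =>
    have ih := ih (by omega)
    rw [sweepPrefix]
    cases h : nextVertex G σ (sweepPrefix G σ i) with
    | some v => simp [ih]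
    | none =>
      exfalso
      rw [nextVertex, List.argmax_eq_none, List.filter_eq_nil_iff] at h
      have hall : ∀ v, v ∈ sweepPrefix G σ i := fun v => by
        simpa using h v (List.mem_reverse.2 (σ.mem_toList v))
      have h1 : (Finset.univ : Finset V) ⊆ (sweepPrefix G σ i).toFinset := fun v _ => by
        simpa using hall v
      have h2 := (Finset.card_le_card h1).trans (List.toFinset_card_le _)
      rw [Finset.card_univ] at h2
      omega

theorem mem_sweepPrefix_card (G : SimpleGraph V) [DecidableRel G.Adj] (σ : VertexOrdering V) (v : V) :
    v ∈ sweepPrefix G σ (Fintype.card V) := by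
  have h : (sweepPrefix G σ (Fintype.card V)).toFinset = Finset.univ := by
    rw [← Finset.card_eq_iff_eq_univ, List.toFinset_card_of_nodup (sweepPrefix_nodup G σ _),
      sweepPrefix_length G σ _ le_rfl]
  rw [← List.mem_toFinset, h]
  exact Finset.mem_univ v

/-- The ordering `LexBFS⁺(G, σ)`: the vertices in the order in which the sweep numbers them. -/
def lexBFSPlus (G : SimpleGraph V) [DecidableRel G.Adj] (σ : VertexOrdering V) : VertexOrdering V :=
  ((sweepPrefix_nodup G σ (Fintype.card V)).getEquivOfForallMemList _
    (mem_sweepPrefix_card G σ)).symm.trans (finCongr (sweepPrefix_length G σ _ le_rfl))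

/-- The lengths of the cycles of LexBFS⁺ sweeps: `k` such that there are distinct orderings
`σ₁, …, σₖ` (`k ≥ 1`) with `σᵢ₊₁ = LexBFS⁺(G, σᵢ)` and `σ₁ = LexBFS⁺(G, σₖ)`; that is, the minimal
periods of the periodic points of the map `σ ↦ LexBFS⁺(G, σ)`. -/
def cycleLengths (G : SimpleGraph V) [DecidableRel G.Adj] : Set ℕ :=
  {k | ∃ σ ∈ Function.periodicPts (lexBFSPlus G), Function.minimalPeriod (lexBFSPlus G) σ = k}

/-- `LexCycle(G)`: the maximum length of a cycle of LexBFS⁺ sweeps. -/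
noncomputable def lexCycle (G : SimpleGraph V) [DecidableRel G.Adj] : ℕ :=
  sSup (cycleLengths G)

end Sweep

end LexBFSCycle

/-!
An order of the vertices is treated through the positions `p : V → ℕ` of the vertices, and the
LexBFS⁺ sweep `q` of `p` through its two characteristic properties (`IsSweep`): the first vertex that
tells two vertices apart is adjacent to the earlier one, and two vertices that are not told apart in
time are reversed. Since the number of orders is finite and no order is its own sweep
(`lexBFSPlus_ne`), it suffices to show that a periodic order returns after two sweeps.

*Periodic sweeps are umbrella-free* (`IsSweepCycle.isUmbrellaFree`). Fix a transitive orientation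
`r` of the complement, and compare the orders of a periodic sequence with `r` and its reverse in
turn. A cell (`IsCell`) is a set of vertices that looks like a module to all vertices except some that
come after it, and these lie above it in `r`. Inside a cell a sweep reverses the non-edges between a
downward closed initial segment and the rest (`IsCell.sweep_reverses`). Cutting cells along such
segments and along joins leads to irreducible cells; every non-edge on which order and orientation
disagree lies in one of them (`exists_irreducible_cell_of_bad`), and each irreducible cell of a sweep
is contained in one of the preceding order (`exists_irreducible_cell_of_sweep`). By periodicity a
largest irreducible cell persists in all orders. Being a cell for `r` and for its reverse, it is a
module, so by induction the sequence is umbrella-free on it and `r` can be reoriented there to agree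
with the orders. For this the cell has to be proper, which is ensured by choosing `r` with the first
vertex of one of the orders as a source (`exists_orientation_of_last`). An `r` with the fewest
disagreements thus has none.

*Two differences make a domino* (`IsSweepCycle.not_isDominoFree`). A sweep of an umbrella-free order
reverses all non-edges (`IsUmbrellaFree.sweep_reverses`). If some order of the sequence differs from
the one two sweeps later, choose such an order whose first difference is at the smallest position.
The two vertices at that position are adjacent and are told apart by vertices in the two sweeps
between; these in turn are told apart by two further vertices, where the case distinction uses the
order two sweeps earlier, which agrees with the given one up to that position. The six vertices
induce a domino.
-/

namespace LexBFSCycle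

/-! ### LexBFS orders and LexBFS⁺ sweeps in terms of positions -/

section Positions

variable {V : Type*}

/-- `w` is the first vertex, in the order of the positions `q`, that is adjacent to exactly one of
`u` and `v`, and the one it is adjacent to is `u`. -/
def Favors (G : SimpleGraph V) (q : V → ℕ) (w u v : V) : Prop :=
  G.Adj w u ∧ ¬ G.Adj w v ∧ ∀ y, q y < q w → (G.Adj y u ↔ G.Adj y v)

/-- The order of the positions `q` is a LexBFS order: if `u` comes before `v` and some vertex before
`u` is adjacent to exactly one of them, then the first such vertex is adjacent to `u`. -/
def IsLexBFS (G : SimpleGraph V) (q : V → ℕ) : Prop :=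
  ∀ u v x, q u < q v → q x < q u → ¬ (G.Adj x u ↔ G.Adj x v) → ∃ w, q w ≤ q x ∧ Favors G q w u v

/-- The order of the positions `q` is the LexBFS⁺ sweep of the order of the positions `p`: it is a
LexBFS order, and ties are resolved in favour of the vertex that is rightmost in `p`. -/
def IsSweep (G : SimpleGraph V) (p q : V → ℕ) : Prop :=
  IsLexBFS G q ∧
    ∀ u v, q u < q v → (∀ x, q x < q u → (G.Adj x u ↔ G.Adj x v)) → p v < p u

end Positions

section Bridge

/-- If the label of `v` is at most the label of `u`, then the first visited vertex adjacent to
exactly one of them is adjacent to `u`. The list `l` is numbered from `k` on. -/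
theorem exists_first_splitter_of_label_le {V : Type*} (G : SimpleGraph V)
    [DecidableRel G.Adj] (m : ℕ) (u v : V) :
    ∀ (l : List V) (k : ℕ), k + l.length ≤ m + 1 →
      ((l.zipIdx k).filterMap fun p => if G.Adj p.1 v then some (m - p.2) else none) ≤
        ((l.zipIdx k).filterMap fun p => if G.Adj p.1 u then some (m - p.2) else none) →
      (∃ x ∈ l, ¬ (G.Adj x u ↔ G.Adj x v)) →
      ∃ l₁ w l₂, l = l₁ ++ w :: l₂ ∧ G.Adj w u ∧ ¬ G.Adj w v ∧ ∀ y ∈ l₁, (G.Adj y u ↔ G.Adj y v) := by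
  intro l
  induction l with
  | nil => intro k _ _ h; simp at h
  | cons a l ih =>
    intro k hk hle hx
    rw [List.zipIdx_cons, List.filterMap_cons, List.filterMap_cons] at hle
    simp only [List.length_cons] at hk
    by_cases hu : G.Adj a u <;> by_cases hv : G.Adj a v
    · simp only [hu, hv, if_true] at hle
      obtain ⟨x, hxl, hxs⟩ := hx
      have hxl' : x ∈ l := by
        rcases List.mem_cons.1 hxl with rfl | h
        · exact absurd (by simp [hu, hv]) hxs
        · exact h
      obtain ⟨l₁, w, l₂, rfl, h1, h2, h3⟩ := ih (k + 1) (by omega)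
        (by
          by_contra hc
          rw [not_le] at hc
          exact absurd hle (not_le.2 (List.cons_lt_cons_self.2 hc))) ⟨x, hxl', hxs⟩
      exact ⟨a :: l₁, w, l₂, rfl, h1, h2, by simpa [hu, hv] using h3⟩
    · exact ⟨[], a, l, rfl, hu, hv, by simp⟩
    · exfalso
      simp only [hu, hv, if_true, if_false] at hle
      refine absurd hle (not_le.2 ?_)
      generalize hL : ((l.zipIdx (k + 1)).filterMap fun p =>
        if G.Adj p.1 u then some (m - p.2) else none) = L
      -- every letter appended later is smaller than the letter appended for `a`
      have hlt : ∀ b ∈ L, b < m - k := by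
        intro b hb
        rw [← hL, List.mem_filterMap] at hb
        obtain ⟨⟨c, i⟩, hci, hb⟩ := hb
        have := List.mem_zipIdx hci
        split_ifs at hb
        simp only [Option.some.injEq] at hb
        omega
      cases L with
      | nil => exact List.nil_lt_cons _ _
      | cons b L => exact List.Lex.rel (hlt b (by simp))
    · simp only [hu, hv, if_false] at hle
      obtain ⟨x, hxl, hxs⟩ := hx
      have hxl' : x ∈ l := by
        rcases List.mem_cons.1 hxl with rfl | h
        · exact absurd (by simp [hu, hv]) hxs
        · exact h
      obtain ⟨l₁, w, l₂, rfl, h1, h2, h3⟩ := ih (k + 1) (by omega) hle ⟨x, hxl', hxs⟩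
      exact ⟨a :: l₁, w, l₂, rfl, h1, h2, by simpa [hu, hv] using h3⟩

theorem pairwise_reverse_toList {V : Type*} [Fintype V] (σ : VertexOrdering V) :
    σ.toList.reverse.Pairwise fun a b => σ b < σ a := by
  rw [List.pairwise_reverse, VertexOrdering.toList, List.pairwise_ofFn]
  intro i j hij
  simpa using hij

variable {V : Type*} [Fintype V] [DecidableEq V] (G : SimpleGraph V) [DecidableRel G.Adj]
  (σ : VertexOrdering V)

theorem sweepPrefix_prefix {i j : ℕ} (h : i ≤ j) : sweepPrefix G σ i <+: sweepPrefix G σ j := by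
  induction j, h using Nat.le_induction with
  | base => exact List.prefix_rfl
  | succ j _ ih => exact ih.trans (by rw [sweepPrefix]; exact List.prefix_append _ _)

theorem sweepPrefix_eq_take {i : ℕ} (h : i ≤ Fintype.card V) :
    sweepPrefix G σ i = (sweepPrefix G σ (Fintype.card V)).take i := by
  have := List.prefix_iff_eq_take.1 (sweepPrefix_prefix G σ h)
  rwa [sweepPrefix_length G σ i h] at this

theorem lexBFSPlus_apply_val (v : V) :
    (lexBFSPlus G σ v : ℕ) = (sweepPrefix G σ (Fintype.card V)).idxOf v := rfl

theorem mem_sweepPrefix_iff {i : ℕ} (h : i ≤ Fintype.card V) (v : V) :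
    v ∈ sweepPrefix G σ i ↔ (lexBFSPlus G σ v : ℕ) < i := by
  rw [lexBFSPlus_apply_val, sweepPrefix_eq_take G σ h]
  constructor
  · intro hv
    have h1 := List.idxOf_lt_length_iff.2 hv
    have h2 := (List.take_prefix i (sweepPrefix G σ (Fintype.card V))).idxOf_eq_of_mem hv
    rw [List.length_take] at h1
    omega
  · intro hv
    rw [List.mem_take_iff_idxOf_lt (mem_sweepPrefix_card G σ v)]
    exact hv

theorem nextVertex_sweepPrefix (u : V) :
    nextVertex G σ (sweepPrefix G σ (lexBFSPlus G σ u)) = some u := by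
  have hlt := (lexBFSPlus G σ u).2
  have h1 := (mem_sweepPrefix_iff G σ (i := lexBFSPlus G σ u + 1) (by omega) u).2 (by omega)
  have h2 := (mem_sweepPrefix_iff G σ (i := lexBFSPlus G σ u) (by omega) u).not.2 (by omega)
  rw [sweepPrefix, List.mem_append] at h1
  simpa [h2] using h1

theorem mem_argmax_lexLabel (u : V) :
    u ∈ @List.argmax V (List ℕ) _ LinearOrder.toDecidableLT
      (lexLabel G (sweepPrefix G σ (lexBFSPlus G σ u)))
      (σ.toList.reverse.filter fun w => w ∉ sweepPrefix G σ (lexBFSPlus G σ u)) := by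
  have hu := nextVertex_sweepPrefix G σ u
  rw [nextVertex, ← Option.mem_def] at hu
  convert hu

theorem isSweep_lexBFSPlus :
    IsSweep G (fun v => (σ v : ℕ)) (fun v => (lexBFSPlus G σ v : ℕ)) := by
  have key : ∀ u v, lexBFSPlus G σ u ≤ lexBFSPlus G σ v →
      v ∈ (σ.toList.reverse.filter fun w => w ∉ sweepPrefix G σ (lexBFSPlus G σ u)) := by
    intro u v huv
    have := (mem_sweepPrefix_iff G σ (i := lexBFSPlus G σ u) (lexBFSPlus G σ u).2.le v).not.2
      (not_lt.2 (Fin.le_def.1 huv))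
    simp [this, σ.mem_toList v]
  refine ⟨?_, ?_⟩
  · intro u v x huv hxu hx
    have hu := mem_argmax_lexLabel G σ u
    have hle := List.le_of_mem_argmax (key u v (le_of_lt huv)) hu
    have hi : (lexBFSPlus G σ u : ℕ) ≤ Fintype.card V := (lexBFSPlus G σ u).2.le
    obtain ⟨l₁, w, l₂, hl, hwu, hwv, hl₁⟩ := exists_first_splitter_of_label_le G
      (Fintype.card V) u v (sweepPrefix G σ (lexBFSPlus G σ u)) 1
      (by rw [sweepPrefix_length G σ _ hi]; omega) hle
      ⟨x, (mem_sweepPrefix_iff G σ hi x).2 hxu, hx⟩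
    have hlen : l₁.length ≤ Fintype.card V := by
      have := congrArg List.length hl
      rw [sweepPrefix_length G σ _ hi, List.length_append] at this
      omega
    have hpre : l₁ = sweepPrefix G σ l₁.length := by
      have h1 : l₁ <+: sweepPrefix G σ (Fintype.card V) := by
        refine List.IsPrefix.trans ?_ (sweepPrefix_prefix G σ hi)
        rw [hl]
        exact List.prefix_append _ _
      rw [sweepPrefix_eq_take G σ hlen]
      exact List.prefix_iff_eq_take.1 h1
    have hbefore : ∀ y, (lexBFSPlus G σ y : ℕ) < lexBFSPlus G σ w → y ∈ l₁ := by
      intro y hy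
      rw [hpre, mem_sweepPrefix_iff G σ hlen]
      have hw : w ∈ sweepPrefix G σ (l₁.length + 1) := by
        have h1 : l₁ ++ [w] <+: sweepPrefix G σ (Fintype.card V) := by
          refine List.IsPrefix.trans ?_ (sweepPrefix_prefix G σ hi)
          rw [hl]
          exact ⟨l₂, by simp⟩
        have hlen' : l₁.length + 1 ≤ Fintype.card V := by
          have := h1.length_le
          rwa [sweepPrefix_length G σ _ le_rfl, List.length_append] at this
        rw [sweepPrefix_eq_take G σ hlen']
        have h2 := List.prefix_iff_eq_take.1 h1
        rw [List.length_append, List.length_singleton] at h2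
        rw [← h2]
        simp
      have hlen' : l₁.length + 1 ≤ Fintype.card V := by
        have := congrArg List.length hl
        rw [sweepPrefix_length G σ _ hi, List.length_append, List.length_cons] at this
        omega
      rw [mem_sweepPrefix_iff G σ hlen'] at hw
      omega
    refine ⟨w, ?_, hwu, hwv, fun y hy => hl₁ y (hbefore y hy)⟩
    by_contra hc
    exact hx (hl₁ x (hbefore x (not_le.1 hc)))
  · intro u v huv hx
    have hu := mem_argmax_lexLabel G σ u
    have hi : (lexBFSPlus G σ u : ℕ) ≤ Fintype.card V := (lexBFSPlus G σ u).2.le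
    have hlab : lexLabel G (sweepPrefix G σ (lexBFSPlus G σ u)) u =
        lexLabel G (sweepPrefix G σ (lexBFSPlus G σ u)) v := by
      refine List.filterMap_congr fun p hp => ?_
      have h1 : p.1 ∈ sweepPrefix G σ (lexBFSPlus G σ u) := List.fst_mem_of_mem_zipIdx hp
      have h2 := hx p.1 ((mem_sweepPrefix_iff G σ hi p.1).1 h1)
      simp only [h2]
    have hidx := List.index_of_argmax hu (key u v (le_of_lt huv)) hlab.le
    have hpw := (pairwise_reverse_toList σ).sublist
      (List.filter_sublist (p := fun w => w ∉ sweepPrefix G σ (lexBFSPlus G σ u)))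
    by_contra hc
    have hne : u ≠ v := by rintro rfl; exact lt_irrefl _ huv
    have hum := key u u le_rfl
    have hvm := key u v (le_of_lt huv)
    have hu1 := List.idxOf_lt_length_iff.2 hum
    have hv1 := List.idxOf_lt_length_iff.2 hvm
    have hlt : List.idxOf u _ < List.idxOf v _ := lt_of_le_of_ne hidx fun h =>
      hne ((List.idxOf_inj hum).1 h)
    have := List.pairwise_iff_getElem.1 hpw _ _ hu1 hv1 hlt
    simp only [List.getElem_idxOf] at this
    exact hc (Fin.lt_def.1 this)

end Bridge

/-! ### Transitive orientations, cells and downward closed prefixes -/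

section Cells

variable {V : Type*}

/-- `r` is a transitive orientation of the complement of `G`. -/
structure IsOrientation (G : SimpleGraph V) (r : V → V → Prop) : Prop where
  irrefl : ∀ x, ¬ r x x
  trans : ∀ x y z, r x y → r y z → r x z
  total : ∀ x y, x ≠ y → ¬ G.Adj x y → r x y ∨ r y x
  not_adj : ∀ x y, r x y → ¬ G.Adj x y

variable {G : SimpleGraph V} {r : V → V → Prop} {p q : V → ℕ}

theorem IsOrientation.asymm (hr : IsOrientation G r) {x y : V} (h : r x y) : ¬ r y x :=
  fun h' => hr.irrefl x (hr.trans _ _ _ h h')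

theorem IsOrientation.swap (hr : IsOrientation G r) : IsOrientation G fun x y => r y x where
  irrefl := hr.irrefl
  trans _ _ _ h h' := hr.trans _ _ _ h' h
  total x y h h' := (hr.total x y h h').symm
  not_adj _ _ h h' := hr.not_adj _ _ h h'.symm

/-- Two non-edges `xz` and `yz` with adjacent `x` and `y` are both oriented towards `z` or both
oriented away from `z`. -/
theorem IsOrientation.force_left (hr : IsOrientation G r) {x y z : V} (h : r x z)
    (hxy : G.Adj y x) (hyz : ¬ G.Adj y z) : r y z := by
  have hne : y ≠ z := by rintro rfl; exact hr.not_adj _ _ h hxy.symm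
  rcases hr.total y z hne hyz with h' | h'
  · exact h'
  · exact absurd hxy.symm (hr.not_adj _ _ (hr.trans _ _ _ h h'))

theorem IsOrientation.force_right (hr : IsOrientation G r) {x y z : V} (h : r z x)
    (hxy : G.Adj y x) (hyz : ¬ G.Adj y z) : r z y :=
  hr.swap.force_left h hxy hyz

/-- `D` is a cell of the order of the positions `p`: a vertex outside of `D` is adjacent to all or
none of `D`, unless it comes after all of `D` and every non-edge between it and `D` is oriented
away from `D`. -/
def IsCell (G : SimpleGraph V) (r : V → V → Prop) (p : V → ℕ) (D : Finset V) : Prop :=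
  ∀ g, g ∉ D → (∀ d ∈ D, ∀ d' ∈ D, G.Adj g d → G.Adj g d') ∨
    ∀ d ∈ D, p d < p g ∧ (¬ G.Adj d g → r d g)

/-- `X` is an initial segment of `D`, and every non-edge between `X` and the rest of `D` is
oriented away from `X`. -/
structure IsDownPrefix (G : SimpleGraph V) (r : V → V → Prop) (p : V → ℕ) (D X : Finset V) :
    Prop where
  subset : X ⊆ D
  mem_of_lt : ∀ x ∈ X, ∀ y ∈ D, p y < p x → y ∈ X
  down : ∀ x ∈ X, ∀ w ∈ D, w ∉ X → ¬ G.Adj x w → r x w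

theorem IsDownPrefix.lt {D X : Finset V} (hX : IsDownPrefix G r p D X)
    (hp : Function.Injective p) {x w : V} (hx : x ∈ X) (hw : w ∈ D) (hwX : w ∉ X) : p x < p w := by
  rcases lt_trichotomy (p x) (p w) with h | h | h
  · exact h
  · exact absurd (hp h ▸ hx) hwX
  · exact absurd (hX.mem_of_lt x hx w hw h) hwX

/-- Within a cell, the first vertex adjacent to exactly one of two vertices lies in the cell. -/
theorem IsCell.exists_favors {D : Finset V} (hD : IsCell G r p D) (hL : IsLexBFS G p) {u v x : V}
    (hu : u ∈ D) (hv : v ∈ D) (huv : p u < p v) (hxu : p x < p u)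
    (hx : ¬ (G.Adj x u ↔ G.Adj x v)) : ∃ w ∈ D, p w ≤ p x ∧ Favors G p w u v := by
  obtain ⟨w, hwx, hw⟩ := hL u v x huv hxu hx
  refine ⟨w, ?_, hwx, hw⟩
  by_contra hwD
  rcases hD w hwD with h | h
  · exact hw.2.1 (h u hu v hv hw.1)
  · exact absurd (h u hu).1 (by omega)

/-- Vertices outside of an initial segment `X` of a cell that have the same neighbours in `X`
are consecutive. -/
theorem IsCell.adj_iff_of_between {D X : Finset V} (hD : IsCell G r p D) (hL : IsLexBFS G p)
    (hp : Function.Injective p) (hX : IsDownPrefix G r p D X) {a b c : V} (ha : a ∈ D)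
    (haX : a ∉ X) (hb : b ∈ D) (hbX : b ∉ X) (hc : c ∈ D) (hab : p a < p b) (hbc : p b < p c)
    (h : ∀ x ∈ X, (G.Adj x a ↔ G.Adj x c)) : ∀ x ∈ X, (G.Adj x b ↔ G.Adj x c) := by
  intro x hx
  by_contra hbx
  have hax : ¬ (G.Adj x a ↔ G.Adj x b) := fun hh => hbx (hh.symm.trans (h x hx))
  obtain ⟨e, heD, hex, he⟩ := hD.exists_favors hL ha hb hab (hX.lt hp hx ha haX) hax
  have mem : ∀ y ∈ D, p y ≤ p x → y ∈ X := fun y hy hyx => by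
    rcases hyx.lt_or_eq with h | h
    · exact hX.mem_of_lt x hx y hy h
    · exact hp h ▸ hx
  have heX := mem e heD hex
  have hec : ¬ (G.Adj e b ↔ G.Adj e c) := fun hh => he.2.1 (hh.2 ((h e heX).1 he.1))
  obtain ⟨f, hfD, hfe, hf⟩ := hD.exists_favors hL hb hc hbc (hX.lt hp heX hb hbX) hec
  have hfX := mem f hfD (hfe.trans hex)
  have hne : f ≠ e := by rintro rfl; exact he.2.1 hf.1
  exact hf.2.1 ((h f hfX).1 ((he.2.2 f (lt_of_le_of_ne hfe fun hh => hne (hp hh))).2 hf.1))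

open Classical in
/-- A downward closed initial segment `X` of a cell extends by the vertices that precede `w` and
are told apart from `w` by `X`. -/
theorem IsCell.isDownPrefix_extend {D X : Finset V} (hr : IsOrientation G r)
    (hD : IsCell G r p D) (hL : IsLexBFS G p) (hp : Function.Injective p)
    (hX : IsDownPrefix G r p D X) {w : V} (hw : w ∈ D) :
    IsDownPrefix G r p D (D.filter fun y => y ∈ X ∨ (p y < p w ∧ ∃ x ∈ X,
      ¬ (G.Adj x y ↔ G.Adj x w))) where
  subset := Finset.filter_subset _ _
  mem_of_lt := by
    intro y hy y' hy' hlt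
    rw [Finset.mem_filter] at hy ⊢
    refine ⟨hy', ?_⟩
    obtain ⟨hyD, hy⟩ := hy
    by_cases hyX' : y' ∈ X
    · exact Or.inl hyX'
    rcases hy with hyX | ⟨hyw, x, hx, hxy⟩
    · exact Or.inl (hX.mem_of_lt y hyX y' hy' hlt)
    · by_cases hyX : y ∈ X
      · exact Or.inl (hX.mem_of_lt y hyX y' hy' hlt)
      refine Or.inr ⟨hlt.trans hyw, ?_⟩
      by_contra hc
      push Not at hc
      exact hxy (hD.adj_iff_of_between hL hp hX hy' hyX' hyD hyX hw hlt hyw hc x hx)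
  down := by
    intro y hy t htD ht hyt
    rw [Finset.mem_filter] at hy ht
    obtain ⟨hyD, hy⟩ := hy
    have htX : t ∉ X := fun h => ht ⟨htD, Or.inl h⟩
    by_cases hyX : y ∈ X
    · exact hX.down y hyX t htD htX hyt
    obtain ⟨hyw, x, hx, hxy⟩ := hy.resolve_left hyX
    have htw : p t < p w → ∀ x ∈ X, (G.Adj x t ↔ G.Adj x w) := by
      intro h x hx
      by_contra hc
      exact ht ⟨htD, Or.inr ⟨h, x, hx, hc⟩⟩
    have hne : y ≠ t := by
      rintro rfl
      exact hxy (htw hyw x hx)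
    -- `X` tells `y` and `t` apart, as it tells `y` and `w` apart
    have hsplit : ∃ x ∈ X, ¬ (G.Adj x y ↔ G.Adj x t) := by
      by_contra hc
      push Not at hc
      rcases lt_trichotomy (p t) (p w) with h | h | h
      · exact hxy ((hc x hx).trans (htw h x hx))
      · exact hxy (hp h ▸ hc x hx)
      · have := hD.adj_iff_of_between hL hp hX hyD hyX hw
          (fun h => absurd (hX.mem_of_lt w h y hyD hyw) hyX) htD hyw h hc x hx
        exact hxy ((hc x hx).trans this.symm)
    obtain ⟨x', hx', hxyt⟩ := hsplit
    have hyt' : p y < p t := by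
      rcases lt_trichotomy (p y) (p t) with h | h | h
      · exact h
      · exact absurd (hp h) hne
      · exact absurd (hD.adj_iff_of_between hL hp hX htD htX hyD hyX hw h hyw
          (htw (h.trans hyw)) x hx) hxy
    obtain ⟨e, heD, hex, he⟩ := hD.exists_favors hL hyD htD hyt' (hX.lt hp hx' hyD hyX) hxyt
    have heX : e ∈ X := by
      rcases hex.lt_or_eq with h | h
      · exact hX.mem_of_lt x' hx' e heD h
      · exact hp h ▸ hx'
    exact hr.force_left (hX.down e heX t htD htX he.2.1) he.1.symm hyt

open Classical in
/-- The sweep reverses every non-edge between a downward closed initial segment of a cell and the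
rest of the cell. The proof is by induction on the size of the rest and, for a fixed `X`, on the
position of `u` in the sweep. -/
theorem IsCell.sweep_reverses {D : Finset V} (hr : IsOrientation G r)
    (hD : IsCell G r p D) (hL : IsLexBFS G p) (hp : Function.Injective p)
    (hq : Function.Injective q) (hs : IsSweep G p q) {X : Finset V}
    (hX : IsDownPrefix G r p D X) {u w : V} (hu : u ∈ X) (hw : w ∈ D) (hwX : w ∉ X)
    (huw : ¬ G.Adj u w) : q w < q u := by
  induction hn : (D \ X).card using Nat.strong_induction_on generalizing X u w with
  | _ n ihX =>
  induction hm : q u using Nat.strong_induction_on generalizing u w with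
  | _ m ihu =>
  subst hm
  by_contra hc
  have hne : u ≠ w := by rintro rfl; exact hwX hu
  have huw' : q u < q w := lt_of_le_of_ne (not_lt.1 hc) fun h => hne (hq h)
  have hpuw : p u < p w := hX.lt hp hu hw hwX
  have hruw := hX.down u hu w hw hwX huw
  -- `u` cannot have won a tie, so a vertex `e` visited earlier prefers `u` to `w`
  have hsplit : ∃ x, q x < q u ∧ ¬ (G.Adj x u ↔ G.Adj x w) := by
    by_contra hcc
    push Not at hcc
    exact absurd (hs.2 u w huw' hcc) (by omega)
  obtain ⟨x, hxu, hx⟩ := hsplit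
  obtain ⟨e, hex, he⟩ := hs.1 u w x huw' hxu hx
  have hrew : r e w := hr.force_left hruw he.1 he.2.1
  have heD : e ∈ D := by
    by_contra heD
    rcases hD e heD with h | h
    · exact he.2.1 (h u (hX.subset hu) w hw he.1)
    · exact hr.asymm hrew ((h w hw).2 fun h => he.2.1 h.symm)
  have heu : q e < q u := hex.trans_lt hxu
  by_cases heX : e ∈ X
  · exact absurd (ihu (q e) heu heX hw hwX he.2.1 rfl) (by omega)
  rcases lt_trichotomy (p w) (p e) with h | h | h
  · obtain ⟨f, hfu, hf⟩ := hL w e u h hpuw fun hh => huw (hh.2 he.1.symm)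
    have hfu' : p f < p u := lt_of_le_of_ne hfu fun hh => huw (hp hh ▸ hf.1)
    have hfD : f ∈ D := by
      by_contra hfD
      rcases hD f hfD with h | h
      · exact hf.2.1 (h w hw e heD hf.1)
      · have := (h u (hX.subset hu)).1
        omega
    have hfX := hX.mem_of_lt u hu f hfD hfu'
    exact hr.not_adj _ _ (hr.trans _ _ _ (hX.down f hfX e heD heX hf.2.1) hrew) hf.1
  · exact hr.irrefl w (hp h ▸ hrew)
  · -- `u` tells `e` and `w` apart, so a larger initial segment separates `e` from `w`
    have hX' := hD.isDownPrefix_extend hr hL hp hX hw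
    have heX' : e ∈ (D.filter fun y => y ∈ X ∨ (p y < p w ∧ ∃ x ∈ X,
        ¬ (G.Adj x y ↔ G.Adj x w))) :=
      Finset.mem_filter.2 ⟨heD, Or.inr ⟨h, u, hu, fun hh => huw (hh.1 he.1.symm)⟩⟩
    have hwX' : w ∉ (D.filter fun y => y ∈ X ∨ (p y < p w ∧ ∃ x ∈ X,
        ¬ (G.Adj x y ↔ G.Adj x w))) := fun h => by
      rcases (Finset.mem_filter.1 h).2 with h | h
      · exact hwX h
      · exact lt_irrefl _ h.1
    refine absurd (ihX _ ?_ hX' heX' hw hwX' he.2.1 rfl) (by omega)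
    rw [← hn]
    refine Finset.card_lt_card (Finset.ssubset_iff_of_subset ?_ |>.2 ⟨e, ?_, ?_⟩)
    · intro y hy
      rw [Finset.mem_sdiff] at hy ⊢
      exact ⟨hy.1, fun h => hy.2 (Finset.mem_filter.2 ⟨hy.1, Or.inl h⟩)⟩
    · exact Finset.mem_sdiff.2 ⟨heD, heX⟩
    · exact fun h => (Finset.mem_sdiff.1 h).2 heX'

end Cells

/-! ### Irreducible cells -/

section Irreducible

variable {V : Type*} {G : SimpleGraph V} {r : V → V → Prop} {p q : V → ℕ}

/-- The complement of `G` is connected on `R`, and no proper nonempty initial segment of `R` is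
downward closed. -/
structure IsIrreducible (G : SimpleGraph V) (r : V → V → Prop) (p : V → ℕ) (R : Finset V) :
    Prop where
  eq_of_complete : ∀ S ⊆ R, S.Nonempty → (∀ x ∈ S, ∀ y ∈ R, y ∉ S → G.Adj x y) → S = R
  eq_of_isDownPrefix : ∀ X, IsDownPrefix G r p R X → X.Nonempty → X = R

/-- A subset of a cell that is completely adjacent to the rest of the cell is a cell. -/
theorem IsCell.of_complete {D S : Finset V} (hD : IsCell G r p D) (hS : S ⊆ D)
    (h : ∀ x ∈ S, ∀ y ∈ D, y ∉ S → G.Adj x y) : IsCell G r p S := by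
  intro g hg
  by_cases hgD : g ∈ D
  · exact Or.inl fun d _ d' hd' _ => (h d' hd' g hgD hg).symm
  · rcases hD g hgD with h' | h'
    · exact Or.inl fun d hd d' hd' => h' d (hS hd) d' (hS hd')
    · exact Or.inr fun d hd => h' d (hS hd)

theorem isDownPrefix_empty (D : Finset V) : IsDownPrefix G r p D ∅ :=
  ⟨by simp, by simp, by simp⟩

theorem isDownPrefix_self (D : Finset V) : IsDownPrefix G r p D D :=
  ⟨subset_rfl, fun _ _ _ hy _ => hy, fun _ _ _ hw hw' => absurd hw hw'⟩

open Classical in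
/-- A nonempty set `U` that is not separated by the two ways of cutting a cell is contained in an
irreducible cell. A cell is cut into sets that are completely adjacent to each other, or into an
initial segment `X` and its complement; in the second case it may be assumed that the vertices of
`U` outside of `X` have the same neighbours in `X`. -/
theorem exists_irreducible_cell [Fintype V] (hr : IsOrientation G r) (hL : IsLexBFS G p)
    (hp : Function.Injective p) {U : Finset V} (hU : U.Nonempty)
    (h₁ : ∀ D S : Finset V, U ⊆ D → S ⊆ D → (∀ x ∈ S, ∀ y ∈ D, y ∉ S → G.Adj x y) →
      U ⊆ S ∨ Disjoint U S)
    (h₂ : ∀ D X : Finset V, IsCell G r p D → U ⊆ D → IsDownPrefix G r p D X →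
      (∀ a ∈ U, a ∉ X → ∀ a' ∈ U, a' ∉ X → ∀ x ∈ X, G.Adj x a → G.Adj x a') →
      U ⊆ X ∨ Disjoint U X) :
    ∃ D, IsCell G r p D ∧ IsIrreducible G r p D ∧ U ⊆ D := by
  obtain ⟨D, hDmem, hDmin⟩ := Finset.exists_min_image
    (Finset.univ.filter fun D : Finset V => IsCell G r p D ∧ U ⊆ D) Finset.card
    ⟨Finset.univ, by
      rw [Finset.mem_filter]
      exact ⟨Finset.mem_univ _, fun g hg => absurd (Finset.mem_univ g) hg, Finset.subset_univ _⟩⟩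
  simp only [Finset.mem_filter, Finset.mem_univ, true_and, and_imp] at hDmem hDmin
  obtain ⟨hD, hUD⟩ := hDmem
  -- by minimality, a cell between `U` and `D` is all of `D`
  have hmin : ∀ S ⊆ D, IsCell G r p S → U ⊆ S → S = D := fun S hSD hS hUS =>
    Finset.eq_of_subset_of_card_le hSD (hDmin S hS hUS)
  refine ⟨D, hD, ⟨?_, ?_⟩, hUD⟩
  · intro S hSD hSne hS
    rcases h₁ D S hUD hSD hS with h | h
    · exact hmin S hSD (hD.of_complete hSD hS) h
    · have hS' : ∀ x ∈ D \ S, ∀ y ∈ D, y ∉ D \ S → G.Adj x y := by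
        intro x hx y hy hyS
        rw [Finset.mem_sdiff] at hx hyS
        have : y ∈ S := by by_contra hc; exact hyS ⟨hy, hc⟩
        exact (hS y this x hx.1 hx.2).symm
      have := hmin (D \ S) Finset.sdiff_subset (hD.of_complete Finset.sdiff_subset hS')
        (Finset.subset_sdiff.2 ⟨hUD, h⟩)
      obtain ⟨x, hx⟩ := hSne
      have hxD := hSD hx
      rw [← this, Finset.mem_sdiff] at hxD
      exact absurd hx hxD.2
  · intro Y hY hYne
    -- `X` is the largest downward closed initial segment not containing `U`
    obtain ⟨X, hXmem, hXmax⟩ := Finset.exists_max_image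
      (Finset.univ.filter fun X : Finset V => IsDownPrefix G r p D X ∧ ¬ U ⊆ X) Finset.card
      ⟨∅, by
        simp only [Finset.mem_filter, Finset.mem_univ, true_and, Finset.subset_empty]
        exact ⟨isDownPrefix_empty D, hU.ne_empty⟩⟩
    simp only [Finset.mem_filter, Finset.mem_univ, true_and, and_imp] at hXmem hXmax
    obtain ⟨hX, hUX⟩ := hXmem
    have hXD : X ⊂ D := Finset.ssubset_iff_subset_ne.2 ⟨hX.subset, fun h => hUX (h ▸ hUD)⟩
    -- `Z` is the next one
    obtain ⟨Z, hZmem, hZmin⟩ := Finset.exists_min_image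
      (Finset.univ.filter fun Z : Finset V => IsDownPrefix G r p D Z ∧ X ⊂ Z) Finset.card
      ⟨D, by
        simp only [Finset.mem_filter, Finset.mem_univ, true_and]
        exact ⟨isDownPrefix_self D, hXD⟩⟩
    simp only [Finset.mem_filter, Finset.mem_univ, true_and, and_imp] at hZmem hZmin
    obtain ⟨hZ, hXZ⟩ := hZmem
    have hUZ : U ⊆ Z := by
      by_contra h
      exact absurd (hXmax Z hZ h) (not_le.2 (Finset.card_lt_card hXZ))
    have htied : ∀ a ∈ Z, a ∉ X → ∀ a' ∈ Z, a' ∉ X → p a < p a' →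
        ∀ x ∈ X, (G.Adj x a ↔ G.Adj x a') := by
      intro a ha haX a' ha' ha'X hlt x hx
      by_contra hc
      have hX' := hD.isDownPrefix_extend hr hL hp hX (hZ.subset ha')
      set X' := D.filter fun y => y ∈ X ∨ (p y < p a' ∧ ∃ x ∈ X, ¬ (G.Adj x y ↔ G.Adj x a'))
        with hX'def
      have haX' : a ∈ X' :=
        Finset.mem_filter.2 ⟨hZ.subset ha, Or.inr ⟨hlt, x, hx, hc⟩⟩
      have ha'X' : a' ∉ X' := fun h => by
        rcases (Finset.mem_filter.1 h).2 with h | h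
        · exact ha'X h
        · exact lt_irrefl _ h.1
      have hXX' : X ⊂ X' :=
        (Finset.ssubset_iff_of_subset fun y hy =>
          Finset.mem_filter.2 ⟨hX.subset hy, Or.inl hy⟩).2 ⟨a, haX', haX⟩
      have hX'Z : X' ⊂ Z := by
        refine (Finset.ssubset_iff_of_subset fun y hy => ?_).2 ⟨a', ha', ha'X'⟩
        by_contra hyZ
        exact ha'X' (hX'.mem_of_lt y hy a' (hZ.subset ha')
          (hZ.lt hp ha' (hX'.subset hy) hyZ))
      exact absurd (hZmin X' hX' hXX') (not_le.2 (Finset.card_lt_card hX'Z))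
    have htied' : ∀ a ∈ Z, a ∉ X → ∀ a' ∈ Z, a' ∉ X → ∀ x ∈ X, G.Adj x a → G.Adj x a' := by
      intro a ha haX a' ha' ha'X x hx
      rcases lt_trichotomy (p a) (p a') with h | h | h
      · exact (htied a ha haX a' ha' ha'X h x hx).1
      · rw [hp h]; exact id
      · exact (htied a' ha' ha'X a ha haX h x hx).2
    have hdis := (h₂ D X hD hUD hX fun a ha haX a' ha' =>
      htied' a (hUZ ha) haX a' (hUZ ha')).resolve_left hUX
    have hB : IsCell G r p (Z \ X) := by
      intro g hg
      by_cases hgX : g ∈ X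
      · refine Or.inl fun d hd d' hd' => ?_
        rw [Finset.mem_sdiff] at hd hd'
        exact htied' d hd.1 hd.2 d' hd'.1 hd'.2 g hgX
      · have hgZ : g ∉ Z := fun h => hg (Finset.mem_sdiff.2 ⟨h, hgX⟩)
        by_cases hgD : g ∈ D
        · refine Or.inr fun d hd => ?_
          rw [Finset.mem_sdiff] at hd
          exact ⟨hZ.lt hp hd.1 hgD hgZ, hZ.down d hd.1 g hgD hgZ⟩
        · have hsub : Z \ X ⊆ D := Finset.sdiff_subset.trans hZ.subset
          rcases hD g hgD with h' | h'
          · exact Or.inl fun d hd d' hd' => h' d (hsub hd) d' (hsub hd')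
          · exact Or.inr fun d hd => h' d (hsub hd)
    have hBD := hmin (Z \ X) (Finset.sdiff_subset.trans hZ.subset) hB
      (Finset.subset_sdiff.2 ⟨hUZ, hdis⟩)
    have hX0 : X = ∅ := by
      rw [Finset.eq_empty_iff_forall_notMem]
      intro x hx
      have := hX.subset hx
      rw [← hBD, Finset.mem_sdiff] at this
      exact this.2 hx
    have hZD : D.card ≤ Z.card := by
      rw [← hBD]
      exact Finset.card_le_card Finset.sdiff_subset
    refine Finset.eq_of_subset_of_card_le hY.subset (hZD.trans (hZmin Y hY ?_))
    rw [hX0]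
    exact Finset.empty_ssubset.2 hYne

open Classical in
/-- The irreducible cells of a sweep, with the reversed orientation, are contained in irreducible
cells of the order it started from. Otherwise a cut `X` would separate such a cell `R`; since the
sweep reverses the non-edges at `X`, this would yield a cut of `R` in the order of the sweep. -/
theorem exists_irreducible_cell_of_sweep [Fintype V] (hr : IsOrientation G r) (hL : IsLexBFS G p)
    (hp : Function.Injective p) (hq : Function.Injective q) (hs : IsSweep G p q) {R : Finset V}
    (hne : R.Nonempty) (hR : IsCell G (fun x y => r y x) q R)
    (hirr : IsIrreducible G (fun x y => r y x) q R) :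
    ∃ D, IsCell G r p D ∧ IsIrreducible G r p D ∧ R ⊆ D := by
  refine exists_irreducible_cell hr hL hp hne ?_ ?_
  · intro D S hRD hSD hS
    by_cases h : (R ∩ S).Nonempty
    · left
      rw [← Finset.inter_eq_left]
      refine hirr.eq_of_complete _ Finset.inter_subset_left h fun x hx y hy hyS => ?_
      rw [Finset.mem_inter] at hx hyS
      exact hS x hx.2 y (hRD hy) fun h => hyS ⟨hy, h⟩
    · right
      rwa [Finset.not_nonempty_iff_eq_empty, ← Finset.disjoint_iff_inter_eq_empty] at h
  · intro D X hD hRD hX htied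
    by_contra hcon
    rw [not_or] at hcon
    obtain ⟨hRX, hdis⟩ := hcon
    obtain ⟨a, haR, haX⟩ := Finset.not_subset.1 hRX
    obtain ⟨s, hsR, hsmin⟩ := Finset.exists_min_image R q hne
    -- nothing before `s` tells the vertices of `R` apart
    have hearly : ∀ x, q x < q s → ∀ d ∈ R, ∀ d' ∈ R, G.Adj x d → G.Adj x d' := by
      intro x hx
      have hxR : x ∉ R := fun h => absurd (hsmin x h) (not_le.2 hx)
      rcases hR x hxR with h | h
      · exact h
      · exact absurd (h s hsR).1 (by omega)
    have hslt : ∀ t ∈ R, t ≠ s → q s < q t := fun t ht hts =>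
      lt_of_le_of_ne (hsmin t ht) fun h => hts (hq h).symm
    have hlast : ∀ t ∈ R, t ≠ s → p t < p s := fun t ht hts =>
      hs.2 s t (hslt t ht hts) fun x hx => ⟨hearly x hx s hsR t ht, hearly x hx t ht s hsR⟩
    have hsX : s ∉ X := fun h => haX (hX.mem_of_lt s h a (hRD haR)
      (hlast a haR (by rintro rfl; exact haX h)))
    -- the vertices of `R` outside of `X`, and those of `X` adjacent to them, come first in `q`
    have hY : IsDownPrefix G (fun x y => r y x) q R (R.filter fun e => e ∉ X ∨ G.Adj e s) := by
      refine ⟨Finset.filter_subset _ _, ?_, ?_⟩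
      · intro y hy t htR hlt
        rw [Finset.mem_filter] at hy ⊢
        obtain ⟨hyR, hy⟩ := hy
        refine ⟨htR, ?_⟩
        by_contra hc
        rw [not_or, not_not] at hc
        obtain ⟨htX, hts⟩ := hc
        have hyX : y ∉ X → False := fun hyX =>
          absurd (hD.sweep_reverses hr hL hp hq hs hX htX (hRD hyR) hyX
            fun h => hts (htied y hyR hyX s hsR hsX t htX h)) (by omega)
        rcases hy with hy | hy
        · exact hyX hy
        · have hst : q s < q t := hslt t htR (by rintro rfl; exact hsX htX)
          obtain ⟨e, hes, he⟩ := hs.1 t y s hlt hst fun h => hts (h.2 hy.symm).symm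
          have hes' : q e < q s := lt_of_le_of_ne hes fun h => hts (hq h ▸ he.1).symm
          exact he.2.1 (hearly e hes' t htR y hyR he.1)
      · intro y hy t htR ht hyt
        rw [Finset.mem_filter] at hy ht
        have htX : t ∈ X := by by_contra h; exact ht ⟨htR, Or.inl h⟩
        have hts : ¬ G.Adj t s := fun h => ht ⟨htR, Or.inr h⟩
        rcases hy.2 with hyX | hys
        · exact hX.down t htX y (hRD hy.1) hyX fun h => hyt h.symm
        · exact hr.force_right (hX.down t htX s (hRD hsR) hsX hts) hys hyt
    have hYR := hirr.eq_of_isDownPrefix _ hY ⟨s, Finset.mem_filter.2 ⟨hsR, Or.inl hsX⟩⟩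
    have hadj : ∀ x ∈ R, x ∈ X → G.Adj x s := fun x hx hxX => by
      rw [← hYR, Finset.mem_filter] at hx
      exact hx.2.resolve_left fun h => h hxX
    have hRXne : (R ∩ X).Nonempty := by
      rwa [Finset.nonempty_iff_ne_empty, Ne, ← Finset.disjoint_iff_inter_eq_empty]
    have := hirr.eq_of_complete (R ∩ X) Finset.inter_subset_left hRXne fun x hx y hy hyX => by
      rw [Finset.mem_inter] at hx hyX
      exact htied s hsR hsX y hy (fun h => hyX ⟨hy, h⟩) x hx.2 (hadj x hx.1 hx.2)
    exact hRX (Finset.inter_eq_left.1 this)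

open Classical in
/-- Every non-edge that disagrees with the order lies in an irreducible cell: neither way of cutting
a cell separates its ends. -/
theorem exists_irreducible_cell_of_bad [Fintype V] (hr : IsOrientation G r) (hL : IsLexBFS G p)
    (hp : Function.Injective p) {x y : V} (hxy : p x < p y) (hyx : r y x) :
    ∃ D, IsCell G r p D ∧ IsIrreducible G r p D ∧ x ∈ D ∧ y ∈ D := by
  have hadj : ¬ G.Adj x y := fun h => hr.not_adj _ _ hyx h.symm
  obtain ⟨D, h1, h2, h3⟩ := exists_irreducible_cell (U := {x, y}) hr hL hp ⟨x, by simp⟩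
    (by
      intro D S hD hSD hS
      have hx : x ∈ D := hD (by simp)
      have hy : y ∈ D := hD (by simp)
      by_cases hxS : x ∈ S <;> by_cases hyS : y ∈ S
      · left; simp [Finset.insert_subset_iff, hxS, hyS]
      · exact absurd (hS x hxS y hy hyS) hadj
      · exact absurd (hS y hyS x hx hxS).symm hadj
      · right; simp [hxS, hyS])
    (by
      intro D X _ hD hX _
      have hx : x ∈ D := hD (by simp)
      have hy : y ∈ D := hD (by simp)
      by_cases hxX : x ∈ X <;> by_cases hyX : y ∈ X
      · left; simp [Finset.insert_subset_iff, hxX, hyX]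
      · exact absurd (hX.down x hxX y hy hyX hadj) (hr.asymm hyx)
      · exact absurd (hX.mem_of_lt y hyX x hx hxy) hxX
      · right; simp [hxX, hyX])
  exact ⟨D, h1, h2, h3 (by simp), h3 (by simp)⟩

/-- An irreducible cell with two vertices contains a non-edge that disagrees with the order. -/
theorem IsIrreducible.exists_bad {R : Finset V} (hp : Function.Injective p)
    (hr : IsOrientation G r) (hR : IsIrreducible G r p R) (h2 : 1 < R.card) :
    ∃ x ∈ R, ∃ y ∈ R, p x < p y ∧ r y x := by
  classical
  obtain ⟨s, hsR, hsmin⟩ := Finset.exists_min_image R p (Finset.card_pos.1 (by omega))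
  by_contra hc
  have hs : IsDownPrefix G r p R {s} := by
    refine ⟨by simpa using hsR, ?_, ?_⟩
    · intro x hx y hy hlt
      rw [Finset.mem_singleton] at hx
      subst hx
      exact absurd (hsmin y hy) (by omega)
    · intro x hx w hw hwX hadj
      rw [Finset.mem_singleton] at hx hwX
      subst hx
      refine (hr.total x w (Ne.symm hwX) hadj).resolve_right fun h => hc ⟨x, hsR, w, hw, ?_, h⟩
      exact lt_of_le_of_ne (hsmin w hw) fun h => hwX (hp h).symm
  have := hR.eq_of_isDownPrefix _ hs ⟨s, by simp⟩
  rw [← this, Finset.card_singleton] at h2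
  omega

/-- A set that is a cell for opposite orientations is a module. -/
theorem IsCell.module {R : Finset V} (hr : IsOrientation G r) (h : IsCell G r p R)
    (h' : IsCell G (fun x y => r y x) q R) {g d d' : V} (hg : g ∉ R) (hd : d ∈ R) (hd' : d' ∈ R)
    (hadj : G.Adj g d) : G.Adj g d' := by
  rcases h g hg with h1 | h1
  · exact h1 d hd d' hd' hadj
  rcases h' g hg with h2 | h2
  · exact h2 d hd d' hd' hadj
  by_contra hc
  have hc' : ¬ G.Adj d' g := fun h => hc h.symm
  exact hr.asymm ((h1 d' hd').2 hc') ((h2 d' hd').2 hc')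

end Irreducible

/-! ### Periodic sequences of sweeps -/

section Reorient

variable {V : Type*} {G : SimpleGraph V} {r : V → V → Prop} {p q : V → ℕ}

/-- The order of the positions `p` has no umbrella: non-adjacency is transitive along it. -/
def IsUmbrellaFree (G : SimpleGraph V) (p : V → ℕ) : Prop :=
  ∀ x y z, p x < p y → p y < p z → ¬ G.Adj x y → ¬ G.Adj y z → ¬ G.Adj x z

/-- A sweep of an umbrella-free order reverses every non-edge. -/
theorem IsUmbrellaFree.sweep_reverses (h : IsUmbrellaFree G p) (hp : Function.Injective p)
    (hq : Function.Injective q) (hs : IsSweep G p q) {u v : V} (huv : ¬ G.Adj u v)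
    (hlt : p u < p v) : q v < q u := by
  induction hn : q u using Nat.strong_induction_on generalizing u with
  | _ n ih =>
  subst hn
  by_contra hc
  have hne : u ≠ v := by rintro rfl; exact lt_irrefl _ hlt
  have hlt' : q u < q v := lt_of_le_of_ne (not_lt.1 hc) fun h => hne (hq h)
  have hsplit : ∃ x, q x < q u ∧ ¬ (G.Adj x u ↔ G.Adj x v) := by
    by_contra hcc
    push Not at hcc
    exact absurd (hs.2 u v hlt' hcc) (by omega)
  obtain ⟨x, hxu, hx⟩ := hsplit
  obtain ⟨e, hex, he⟩ := hs.1 u v x hlt' hxu hx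
  rcases lt_trichotomy (p e) (p v) with h' | h' | h'
  · exact absurd (ih (q e) (hex.trans_lt hxu) he.2.1 h' rfl) (by omega)
  · exact huv (hp h' ▸ he.1).symm
  · exact h u v e hlt h' huv (fun hh => he.2.1 hh.symm) he.1.symm

/-- No vertex outside of `R` is adjacent to some but not all vertices of `R`. -/
def IsModule (G : SimpleGraph V) (R : Finset V) : Prop :=
  ∀ g, g ∉ R → ∀ d ∈ R, ∀ d' ∈ R, G.Adj g d → G.Adj g d'

/-- Sweeps restrict to modules. -/
theorem IsSweep.restrict (hs : IsSweep G p q) {R : Finset V} (hR : IsModule G R) :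
    IsSweep (G.comap ((↑) : R → V)) (fun x => p x) (fun x => q x) := by
  refine ⟨fun u v x huv hxu hx => ?_, fun u v huv hx => hs.2 u v huv fun x hxu => ?_⟩
  · obtain ⟨w, hwx, hw⟩ := hs.1 u v x huv hxu hx
    by_cases hwR : w ∈ R
    · exact ⟨⟨w, hwR⟩, hwx, hw.1, hw.2.1, fun y hy => hw.2.2 y hy⟩
    · exact absurd (hR w hwR u u.2 v v.2 hw.1) hw.2.1
  · by_cases hxR : x ∈ R
    · exact hx ⟨x, hxR⟩ hxu
    · exact ⟨hR x hxR u u.2 v v.2, hR x hxR v v.2 u u.2⟩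

open Classical in
/-- The orientation obtained from `r` by orienting the non-edges inside `R` along the order of the
positions `p`, and the other non-edges at `R` as those at the vertex `c`. -/
def reorient (G : SimpleGraph V) (r : V → V → Prop) (p : V → ℕ) (R : Finset V) (c : V) :
    V → V → Prop := fun x y =>
  if x ∈ R then if y ∈ R then p x < p y ∧ ¬ G.Adj x y else r c y
  else if y ∈ R then r x c else r x y

theorem IsOrientation.reorient (hr : IsOrientation G r) (hp : Function.Injective p) {R : Finset V}
    (hR : IsModule G R) {c : V} (hc : c ∈ R)
    (htr : ∀ x ∈ R, ∀ y ∈ R, ∀ z ∈ R, p x < p y → p y < p z → ¬ G.Adj x y → ¬ G.Adj y z →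
      ¬ G.Adj x z) :
    IsOrientation G (reorient G r p R c) where
  irrefl x := by
    unfold LexBFSCycle.reorient
    split_ifs with h
    · exact fun h => lt_irrefl _ h.1
    · exact hr.irrefl x
  trans x y z := by
    unfold LexBFSCycle.reorient
    by_cases hx : x ∈ R <;> by_cases hy : y ∈ R <;> by_cases hz : z ∈ R <;>
      simp only [hx, hy, hz, if_true, if_false]
    · exact fun h h' => ⟨h.1.trans h'.1, htr x hx y hy z hz h.1 h'.1 h.2 h'.2⟩
    · exact fun _ h => h
    · exact fun h h' => absurd (hr.trans _ _ _ h h') (hr.irrefl c)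
    · exact hr.trans _ _ _
    · exact fun h _ => h
    all_goals exact hr.trans _ _ _
  total x y hxy hadj := by
    unfold LexBFSCycle.reorient
    by_cases hx : x ∈ R <;> by_cases hy : y ∈ R <;> simp only [hx, hy, if_true, if_false]
    · rcases lt_trichotomy (p x) (p y) with h | h | h
      · exact Or.inl ⟨h, hadj⟩
      · exact absurd (hp h) hxy
      · exact Or.inr ⟨h, fun h => hadj h.symm⟩
    · exact hr.total c y (by rintro rfl; exact hy hc)
        fun h => hadj (hR y hy c hc x hx h.symm).symm
    · exact hr.total x c (by rintro rfl; exact hx hc) fun h => hadj (hR x hx c hc y hy h)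
    · exact hr.total x y hxy hadj
  not_adj x y := by
    unfold LexBFSCycle.reorient
    by_cases hx : x ∈ R <;> by_cases hy : y ∈ R <;> simp only [hx, hy, if_true, if_false]
    · exact fun h => h.2
    · exact fun h hadj => hr.not_adj _ _ h (hR y hy x hx c hc hadj.symm).symm
    · exact fun h hadj => hr.not_adj _ _ h (hR x hx y hy c hc hadj)
    · exact hr.not_adj x y

open Classical in
/-- A module that is an irreducible cell and is not contained in a larger one is also a module of
the orientation: no vertex outside of it lies between two of its vertices. -/
theorem IsIrreducible.not_between [Fintype V] (hr : IsOrientation G r) (hL : IsLexBFS G p)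
    (hp : Function.Injective p) {R : Finset V} (hR : IsModule G R) (hirr : IsIrreducible G r p R)
    (hmax : ∀ D, IsCell G r p D → IsIrreducible G r p D → D.card ≤ R.card) {z d d' : V}
    (hz : z ∉ R) (hd : d ∈ R) (hd' : d' ∈ R) (h : r d z) (h' : r z d') : False := by
  have hzR : ∀ x ∈ R, ¬ G.Adj x z := fun x hx hadj =>
    hr.not_adj _ _ h (hR z hz x hx d hd hadj.symm).symm
  obtain ⟨D, hD, hDirr, hsub⟩ := exists_irreducible_cell (U := insert z R) hr hL hp
    ⟨z, by simp⟩
    (by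
      intro D S hRD hSD hS
      rw [Finset.insert_subset_iff] at hRD
      by_cases hne : (R ∩ S).Nonempty
      · have hRS := hirr.eq_of_complete _ Finset.inter_subset_left hne fun x hx y hy hyS => by
          rw [Finset.mem_inter] at hx hyS
          exact hS x hx.2 y (hRD.2 hy) fun h => hyS ⟨hy, h⟩
        rw [Finset.inter_eq_left] at hRS
        refine Or.inl (Finset.insert_subset_iff.2 ⟨?_, hRS⟩)
        by_contra hzS
        exact hzR d hd (hS d (hRS hd) z hRD.1 hzS)
      · rw [Finset.not_nonempty_iff_eq_empty, ← Finset.disjoint_iff_inter_eq_empty] at hne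
        refine Or.inr (Finset.disjoint_insert_left.2 ⟨fun hzS => ?_, hne⟩)
        exact hzR d hd (hS z hzS d (hRD.2 hd) (Finset.disjoint_left.1 hne hd)).symm)
    (by
      intro D X _ hRD hX _
      rw [Finset.insert_subset_iff] at hRD
      by_cases hne : (R ∩ X).Nonempty
      · have hRX := hirr.eq_of_isDownPrefix (R ∩ X) ⟨Finset.inter_subset_left,
          fun x hx y hy hlt => Finset.mem_inter.2
            ⟨hy, hX.mem_of_lt x (Finset.mem_inter.1 hx).2 y (hRD.2 hy) hlt⟩,
          fun x hx w hw hwX => hX.down x (Finset.mem_inter.1 hx).2 w (hRD.2 hw)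
            fun h => hwX (Finset.mem_inter.2 ⟨hw, h⟩)⟩ hne
        rw [Finset.inter_eq_left] at hRX
        refine Or.inl (Finset.insert_subset_iff.2 ⟨?_, hRX⟩)
        by_contra hzX
        exact hr.asymm h' (hX.down d' (hRX hd') z hRD.1 hzX (hzR d' hd'))
      · rw [Finset.not_nonempty_iff_eq_empty, ← Finset.disjoint_iff_inter_eq_empty] at hne
        refine Or.inr (Finset.disjoint_insert_left.2 ⟨fun hzX => ?_, hne⟩)
        exact hr.asymm h (hX.down z hzX d (hRD.2 hd) (Finset.disjoint_left.1 hne hd)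
          fun hh => hzR d hd hh.symm))
  have := (Finset.card_le_card hsub).trans (hmax D hD hDirr)
  rw [Finset.card_insert_of_notMem hz] at this
  omega

end Reorient

section Periodic

variable {V : Type*} {G : SimpleGraph V} {r : V → V → Prop} {p : ℕ → V → ℕ} {K : ℕ}

/-- A sequence of orders with period `K`, each of which is the LexBFS⁺ sweep of the one before. -/
structure IsSweepCycle (G : SimpleGraph V) (p : ℕ → V → ℕ) (K : ℕ) : Prop where
  pos : 0 < K
  injective : ∀ j, Function.Injective (p j)
  sweep : ∀ j, IsSweep G (p j) (p (j + 1))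
  period : ∀ j, p (j + K) = p j

theorem IsSweepCycle.period_mul (h : IsSweepCycle G p K) (j m : ℕ) : p (j + m * K) = p j := by
  induction m with
  | zero => simp
  | succ m ih => rw [Nat.succ_mul, ← add_assoc, h.period, ih]

theorem IsSweepCycle.isLexBFS (h : IsSweepCycle G p K) (j : ℕ) : IsLexBFS G (p j) := by
  have h1 := h.sweep (j + (K - 1))
  have hK := h.pos
  rw [show j + (K - 1) + 1 = j + K by omega, h.period] at h1
  exact h1.1

theorem IsSweepCycle.restrict (h : IsSweepCycle G p K) {R : Finset V} (hR : IsModule G R) :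
    IsSweepCycle (G.comap ((↑) : R → V)) (fun j x => p j x) K where
  pos := h.pos
  injective j := (h.injective j).comp Subtype.val_injective
  sweep j := (h.sweep j).restrict hR
  period j := by funext x; rw [h.period]

/-- The orientation that the `j`-th order of a sequence of sweeps should follow: `r` and its
reverse alternate. -/
def orient (r : V → V → Prop) (j : ℕ) : V → V → Prop :=
  fun x y => if Even j then r x y else r y x

theorem orient_succ (r : V → V → Prop) (j : ℕ) :
    orient r j = fun x y => orient r (j + 1) y x := by
  funext x y
  by_cases h : Even j <;> simp [orient, h, Nat.even_add_one]

theorem orient_succ' (r : V → V → Prop) (j : ℕ) :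
    orient r (j + 1) = fun x y => orient r j y x := by
  rw [orient_succ r j]

theorem orient_add {K : ℕ} (hK : Even K) (r : V → V → Prop) (j m : ℕ) :
    orient r (j + m * K) = orient r j := by
  funext x y
  simp [orient, Nat.even_add, hK.mul_left m]

theorem IsOrientation.orient (hr : IsOrientation G r) (j : ℕ) : IsOrientation G (orient r j) := by
  by_cases h : Even j
  · convert hr using 1
    funext x y
    simp [LexBFSCycle.orient, h]
  · convert hr.swap using 1
    funext x y
    simp [LexBFSCycle.orient, h]

/-- If some order of a sequence of sweeps disagrees with the orientation, then a largest irreducible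
cell is an irreducible cell of all orders of the sequence. -/
theorem IsSweepCycle.exists_irreducible_cell [Fintype V] (h : IsSweepCycle G p K) (hK : Even K)
    (hr : IsOrientation G r) (hbad : ∃ j x y, p j x < p j y ∧ orient r j y x) :
    ∃ R : Finset V, 1 < R.card ∧
      (∀ j, IsCell G (orient r j) (p j) R ∧ IsIrreducible G (orient r j) (p j) R) ∧
      ∀ j D, IsCell G (orient r j) (p j) D → IsIrreducible G (orient r j) (p j) D →
        D.card ≤ R.card := by
  classical
  -- the pairs `(j, D)` with `D` an irreducible cell of the `j`-th order
  let T : Set (ℕ × Finset V) := {a | IsCell G (orient r a.1) (p a.1) a.2 ∧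
    IsIrreducible G (orient r a.1) (p a.1) a.2}
  obtain ⟨j₀, x, y, hxy, hyx⟩ := hbad
  obtain ⟨D₀, hD₀, hD₀', hx, hy⟩ :=
    exists_irreducible_cell_of_bad (hr.orient j₀) (h.isLexBFS j₀) (h.injective j₀) hxy hyx
  obtain ⟨⟨j, R⟩, hjR, hmax⟩ := WellFounded.has_min
    (measure fun a : ℕ × Finset V => Fintype.card V - a.2.card).wf T ⟨(j₀, D₀), hD₀, hD₀'⟩
  have hmax' : ∀ i D, IsCell G (orient r i) (p i) D → IsIrreducible G (orient r i) (p i) D →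
      D.card ≤ R.card := by
    intro i D h1 h2
    have h3 : ¬ (Fintype.card V - D.card < Fintype.card V - R.card) := hmax (i, D) ⟨h1, h2⟩
    have h4 := Finset.card_le_univ D
    have h5 := Finset.card_le_univ R
    omega
  have hcard : 1 < R.card := by
    refine lt_of_lt_of_le (Finset.one_lt_card.2 ⟨x, hx, y, hy, ?_⟩) (hmax' j₀ D₀ hD₀ hD₀')
    rintro rfl
    exact lt_irrefl _ hxy
  -- a largest cell passes to the preceding order, hence by periodicity to all orders
  have hstep : ∀ i, (i + 1, R) ∈ T → (i, R) ∈ T := by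
    intro i hi
    have hi' : IsCell G (orient r (i + 1)) (p (i + 1)) R ∧
      IsIrreducible G (orient r (i + 1)) (p (i + 1)) R := hi
    rw [orient_succ'] at hi'
    obtain ⟨D, hD, hD', hRD⟩ := exists_irreducible_cell_of_sweep (hr.orient i) (h.isLexBFS i)
      (h.injective i) (h.injective (i + 1)) (h.sweep i) (Finset.card_pos.1 (by omega)) hi'.1 hi'.2
    have := Finset.eq_of_subset_of_card_le hRD (hmax' i D hD hD')
    subst this
    exact ⟨hD, hD'⟩
  have hdown : ∀ m i, (i + m, R) ∈ T → (i, R) ∈ T := by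
    intro m
    induction m with
    | zero => exact fun i hi => hi
    | succ m ih => exact fun i hi => ih i (hstep (i + m) hi)
  refine ⟨R, hcard, fun i => ?_, hmax'⟩
  have hle : i ≤ j + i * K := le_add_of_le_right (Nat.le_mul_of_pos_right i h.pos)
  refine hdown (j + i * K - i) i ?_
  rw [Nat.add_sub_cancel' hle]
  show _ ∧ _
  simp only [orient_add hK, h.period_mul]
  exact hjR

end Periodic

/-! ### Periodic sweeps are umbrella-free -/

section UmbrellaFree

/-- Some transitive orientation has the first vertex `z` of the sweep of `σ` as a source, provided
that the order `τ` is umbrella-free on proper modules and starts with `z`. -/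
theorem exists_orientation_of_last {V : Type*} [Fintype V] {G : SimpleGraph V} {σ τ : V → ℕ}
    (hG : ∃ r, IsOrientation G r) (hL : IsLexBFS G σ) (hσ : Function.Injective σ)
    (hτ : Function.Injective τ) {z : V} (hlast : ∀ w, w ≠ z → σ w < σ z)
    (hfirst : ∀ w, w ≠ z → τ z < τ w)
    (hmod : ∀ R : Finset V, R ≠ Finset.univ → IsModule G R →
      ∀ x ∈ R, ∀ y ∈ R, ∀ w ∈ R, τ x < τ y → τ y < τ w → ¬ G.Adj x y → ¬ G.Adj y w →
        ¬ G.Adj x w) :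
    ∃ r, IsOrientation G r ∧ ∀ w, w ≠ z → ¬ G.Adj z w → r z w := by
  classical
  -- reversing the orientation if necessary, the first non-neighbour `c` of `z` comes after `z`
  obtain ⟨r, hr, hA⟩ : ∃ r, IsOrientation G r ∧ ∀ b, r b z →
      ∃ c, r z c ∧ σ c < σ b := by
    obtain ⟨r, hr⟩ := hG
    by_cases hne : ∃ w, w ≠ z ∧ ¬ G.Adj z w
    · obtain ⟨c, hc, hcmin⟩ := Finset.exists_min_image
        (Finset.univ.filter fun w => w ≠ z ∧ ¬ G.Adj z w) σ (by
          obtain ⟨w, hw⟩ := hne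
          exact ⟨w, by simpa using hw⟩)
      simp only [Finset.mem_filter, Finset.mem_univ, true_and, and_imp] at hc hcmin
      have key : ∀ r : V → V → Prop, IsOrientation G r → r z c → ∀ b, r b z → σ c < σ b := by
        intro r hr hzc b hbz
        refine lt_of_le_of_ne (hcmin b ?_ fun h => hr.not_adj _ _ hbz h.symm) fun h => ?_
        · rintro rfl
          exact hr.irrefl _ hbz
        · rw [hσ h] at hzc
          exact hr.asymm hzc hbz
      rcases hr.total z c hc.1.symm hc.2 with h | h
      · exact ⟨r, hr, fun b hb => ⟨c, h, key r hr h b hb⟩⟩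
      · exact ⟨_, hr.swap, fun b hb => ⟨c, h, key _ hr.swap h b hb⟩⟩
    · refine ⟨r, hr, fun b hb => absurd ⟨b, ?_, fun h => hr.not_adj _ _ hb h.symm⟩ hne⟩
      rintro rfl
      exact hr.irrefl _ hb
  by_cases hB : ∃ b, r b z
  swap
  · refine ⟨r, hr, fun w hw hzw => (hr.total z w hw.symm hzw).resolve_right fun h => hB ⟨w, h⟩⟩
  obtain ⟨b, hb, hbmin⟩ := Finset.exists_min_image (Finset.univ.filter fun b => r b z) σ (by
    obtain ⟨b, hb⟩ := hB
    exact ⟨b, by simpa using hb⟩)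
  simp only [Finset.mem_filter, Finset.mem_univ, true_and] at hb hbmin
  obtain ⟨c, hzc, hcb⟩ := hA b hb
  have hbz : σ b < σ z := hlast b (by rintro rfl; exact hr.irrefl _ hb)
  have hsub : ∀ s, G.Adj s b → s ≠ z → σ s < σ b → G.Adj s z := by
    intro s hsb hsz hlt
    by_contra hc
    rcases hr.total s z hsz hc with h | h
    · exact absurd (hbmin s h) (by omega)
    · exact hr.not_adj _ _ (hr.trans _ _ _ hb h) hsb.symm
  have hbz' : ∀ x, σ x < σ b → (G.Adj x b ↔ G.Adj x z) := by
    intro x hx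
    by_contra hc
    obtain ⟨e, hex, he⟩ := hL b z x hbz hx hc
    refine he.2.1 (hsub e he.1 ?_ (by omega))
    rintro rfl
    omega
  -- the vertices from `b` on form a module
  have hM : IsModule G (Finset.univ.filter fun y => σ b ≤ σ y) := by
    have hiff : ∀ g, σ g < σ b → ∀ d, σ b ≤ σ d → (G.Adj g d ↔ G.Adj g z) := by
      have hS : IsDownPrefix G (fun _ _ => True) σ Finset.univ
          (Finset.univ.filter fun y => σ y < σ b) :=
        ⟨Finset.subset_univ _, fun x hx y _ hy => by
          simp only [Finset.mem_filter, Finset.mem_univ, true_and] at hx ⊢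
          omega, fun _ _ _ _ _ _ => trivial⟩
      have hC : IsCell G (fun _ _ => True) σ Finset.univ :=
        fun g hg => absurd (Finset.mem_univ g) hg
      intro g hg d hd
      rcases hd.lt_or_eq with hlt | heq
      · by_cases hdz : d = z
        · rw [hdz]
        · exact hC.adj_iff_of_between hL hσ hS (Finset.mem_univ b) (by simp) (Finset.mem_univ d)
            (by simpa using hd) (Finset.mem_univ z) hlt (hlast d hdz)
            (fun x hx => hbz' x (by simpa using hx)) g (by simpa using hg)
      · rw [← hσ heq]
        exact hbz' g hg
    intro g hg d hd d' hd' hadj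
    simp only [Finset.mem_filter, Finset.mem_univ, true_and, not_le] at hg hd hd'
    exact (hiff g hg d' hd').2 ((hiff g hg d hd).1 hadj)
  have hne : (Finset.univ.filter fun y => σ b ≤ σ y) ≠ Finset.univ := by
    intro h
    have := Finset.mem_univ c
    rw [← h, Finset.mem_filter] at this
    omega
  have hzM : z ∈ Finset.univ.filter fun y => σ b ≤ σ y := by simpa using hbz.le
  refine ⟨_, hr.reorient hτ hM hzM (hmod _ hne hM), fun w hwz hzw => ?_⟩
  unfold reorient
  rw [if_pos hzM]
  split_ifs with hw
  · exact ⟨hfirst w hwz, hzw⟩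
  · simp only [Finset.mem_filter, Finset.mem_univ, true_and, not_le] at hw
    exact (hr.total z w hwz.symm hzw).resolve_right fun h => absurd (hbmin w h) (by omega)

/-- Along a sequence of sweeps of umbrella-free orders, the order of a non-edge alternates. -/
theorem IsSweepCycle.alternates {V : Type*} {G : SimpleGraph V} {p : ℕ → V → ℕ} {K : ℕ}
    (h : IsSweepCycle G p K) (hu : ∀ j, IsUmbrellaFree G (p j)) {x y : V} (hxy : ¬ G.Adj x y)
    (hlt : p 0 x < p 0 y) (j : ℕ) : if Even j then p j x < p j y else p j y < p j x := by
  induction j with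
  | zero => simpa using hlt
  | succ j ih =>
    by_cases hj : Even j
    · rw [if_pos hj] at ih
      rw [if_neg (by simpa [Nat.even_add_one] using hj)]
      exact (hu j).sweep_reverses (h.injective j) (h.injective (j + 1)) (h.sweep j) hxy ih
    · rw [if_neg hj] at ih
      rw [if_pos (by simpa [Nat.even_add_one] using hj)]
      exact (hu j).sweep_reverses (h.injective j) (h.injective (j + 1)) (h.sweep j)
        (fun h => hxy h.symm) ih

universe u

/-- All orders of a periodic sequence of LexBFS⁺ sweeps of a cocomparability graph are
umbrella-free. The proof is by induction on the number of vertices: the sequence restricts to proper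
modules. Among the orientations for which the first vertex `z` of the order `p 0` is a source, one
is chosen that the sequence follows as closely as possible. If it is not followed everywhere, then
some module `R` is an irreducible cell of all orders. It is proper because `{z}` is downward closed
in the whole vertex set, and reorienting `R` along `p 0` gives a better orientation. -/
theorem IsSweepCycle.isUmbrellaFree {V : Type u} [Fintype V] {G : SimpleGraph V}
    {p : ℕ → V → ℕ} {K : ℕ} (h : IsSweepCycle G p K) (hG : ∃ r, IsOrientation G r) (j : ℕ) :
    IsUmbrellaFree G (p j) := by
  induction hn : Fintype.card V using Nat.strong_induction_on generalizing V j K with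
  | _ n ih =>
  subst hn
  classical
  -- a period may be doubled, so that the alternation of orientations is compatible with it
  wlog hK : Even K generalizing K
  · refine this (K := 2 * K) ⟨by have := h.pos; omega, h.injective, h.sweep, fun j => ?_⟩
      (even_two_mul K)
    exact h.period_mul j 2
  rcases isEmpty_or_nonempty V with hV | hV
  · exact fun x => (hV.false x).elim
  have hsub : ∀ R : Finset V, R ≠ Finset.univ → IsModule G R → ∀ j,
      IsUmbrellaFree (G.comap ((↑) : R → V)) (fun x => p j x) := by
    intro R hR hmod j
    refine ih (Fintype.card R) ?_ (h.restrict hmod) ?_ j rfl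
    · rw [Fintype.card_coe]
      exact (Finset.card_lt_iff_ne_univ R).2 hR
    · obtain ⟨r, hr⟩ := hG
      exact ⟨fun x y => r x y, fun x => hr.irrefl x, fun x y z => hr.trans x y z,
        fun x y hxy => hr.total x y fun h => hxy (Subtype.ext h), fun x y => hr.not_adj x y⟩
  have hsub' : ∀ R : Finset V, R ≠ Finset.univ → IsModule G R → ∀ j, ∀ x ∈ R, ∀ y ∈ R, ∀ w ∈ R,
      p j x < p j y → p j y < p j w → ¬ G.Adj x y → ¬ G.Adj y w → ¬ G.Adj x w :=
    fun R hR hmod j x hx y hy w hw => hsub R hR hmod j ⟨x, hx⟩ ⟨y, hy⟩ ⟨w, hw⟩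
  obtain ⟨z, -, hz⟩ := Finset.exists_min_image Finset.univ (p 0) Finset.univ_nonempty
  have hfirst : ∀ w, w ≠ z → p 0 z < p 0 w := fun w hw =>
    lt_of_le_of_ne (hz w (Finset.mem_univ w)) fun hh => hw (h.injective 0 hh).symm
  have hsw : IsSweep G (p (K - 1)) (p 0) := by
    have h1 := h.sweep (K - 1)
    have hK := h.pos
    have h2 := h.period 0
    rw [zero_add] at h2
    rwa [Nat.sub_add_cancel hK, h2] at h1
  have hlast : ∀ w, w ≠ z → p (K - 1) w < p (K - 1) z := fun w hw =>
    hsw.2 z w (hfirst w hw) fun x hx => absurd (hz x (Finset.mem_univ x)) (by omega)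
  -- an orientation with source `z` from which the orders deviate least
  let bad : (V → V → Prop) → Finset (ℕ × V × V) := fun r =>
    (Finset.range K ×ˢ Finset.univ ×ˢ Finset.univ).filter fun a =>
      p a.1 a.2.1 < p a.1 a.2.2 ∧ orient r a.1 a.2.2 a.2.1
  obtain ⟨r, ⟨hr, hrz⟩, hmin⟩ := WellFounded.has_min
    (measure fun r : V → V → Prop => (bad r).card).wf
    {r | IsOrientation G r ∧ ∀ w, w ≠ z → ¬ G.Adj z w → r z w}
    (exists_orientation_of_last hG (h.isLexBFS (K - 1)) (h.injective (K - 1)) (h.injective 0)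
      hlast hfirst fun R hR hmod => hsub' R hR hmod 0)
  by_cases hbad : ∃ j x y, p j x < p j y ∧ orient r j y x
  swap
  · have hlt : ∀ x y, p j x < p j y → ¬ G.Adj x y → orient r j x y := fun x y hxy hadj =>
      ((hr.orient j).total x y (by rintro rfl; exact lt_irrefl _ hxy) hadj).resolve_right
        fun hyx => hbad ⟨j, x, y, hxy, hyx⟩
    exact fun x y w hxy hyw hxy' hyw' => (hr.orient j).not_adj _ _
      ((hr.orient j).trans _ _ _ (hlt x y hxy hxy') (hlt y w hyw hyw'))
  exfalso
  obtain ⟨R, hcard, hR, hmax⟩ := h.exists_irreducible_cell hK hr hbad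
  have hmod : IsModule G R := by
    intro g hg d hd d' hd' hadj
    have h1 := (hR 1).1
    rw [orient_succ'] at h1
    exact (hR 0).1.module (hr.orient 0) h1 hg hd hd' hadj
  have horient0 : orient r 0 = r := by funext x y; simp [orient]
  have hR0 := hR 0
  rw [horient0] at hR0
  have hne : R ≠ Finset.univ := by
    intro hRu
    have hzp : IsDownPrefix G r (p 0) R {z} := by
      refine ⟨by simp [hRu], ?_, ?_⟩
      · intro x hx y _ hlt
        rw [Finset.mem_singleton] at hx
        subst hx
        exact absurd (hz y (Finset.mem_univ y)) (by omega)
      · intro x hx w _ hw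
        rw [Finset.mem_singleton] at hx hw
        subst hx
        exact hrz w hw
    have := hR0.2.eq_of_isDownPrefix _ hzp ⟨z, by simp⟩
    rw [← this, Finset.card_singleton] at hcard
    omega
  -- following the orders inside of `R` makes the deviation smaller
  obtain ⟨c, hc⟩ := Finset.card_pos.1 (show 0 < R.card by omega)
  have hr' := hr.reorient (h.injective 0) hmod hc (hsub' R hne hmod 0)
  have hbetween : ∀ {y d d' : V}, y ∉ R → d ∈ R → d' ∈ R → r d y → r y d' → False :=
    fun hy hd hd' => hR0.2.not_between hr (h.isLexBFS 0) (h.injective 0) hmod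
      (fun D h1 h2 => hmax 0 D (by rwa [horient0]) (by rwa [horient0])) hy hd hd'
  have hadjR : ∀ {y d d' : V}, y ∉ R → d ∈ R → d' ∈ R → ¬ G.Adj d y → ¬ G.Adj d' y :=
    fun hy hd hd' hadj h' => hadj (hmod _ hy _ hd' _ hd h'.symm).symm
  have hneR : ∀ {y d : V}, y ∉ R → d ∈ R → d ≠ y := by
    rintro y d hy hd rfl
    exact hy hd
  -- outside of `R` the new orientation agrees with the old one
  have hout : ∀ x y, ¬ (x ∈ R ∧ y ∈ R) → (reorient G r (p 0) R c x y ↔ r x y) := by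
    intro x y hxy
    unfold reorient
    by_cases hx : x ∈ R <;> by_cases hy : y ∈ R <;> simp only [hx, hy, if_true, if_false]
    · exact absurd ⟨hx, hy⟩ hxy
    · constructor <;> intro hh
      · exact (hr.total x y (hneR hy hx) (hadjR hy hc hx (hr.not_adj _ _ hh))).resolve_right
          fun h' => hbetween hy hc hx hh h'
      · exact (hr.total c y (hneR hy hc) (hadjR hy hx hc (hr.not_adj _ _ hh))).resolve_right
          fun h' => hbetween hy hx hc hh h'
    · constructor <;> intro hh
      · exact (hr.total x y (hneR hx hy).symm fun h' => hadjR hx hc hy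
          (fun h'' => hr.not_adj _ _ hh h''.symm) h'.symm).resolve_right
          fun h' => hbetween hx hy hc h' hh
      · exact (hr.total x c (hneR hx hc).symm fun h' => hadjR hx hy hc
          (fun h'' => hr.not_adj _ _ hh h''.symm) h'.symm).resolve_right
          fun h' => hbetween hx hc hy h' hh
  have hin : ∀ x ∈ R, ∀ y ∈ R, ∀ i, orient (reorient G r (p 0) R c) i y x → ¬ p i x < p i y := by
    intro x hx y hy i hor
    have halt : ∀ x ∈ R, ∀ y ∈ R, ¬ G.Adj x y → p 0 x < p 0 y →
        if Even i then p i x < p i y else p i y < p i x := fun x hx y hy hadj hlt =>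
      (h.restrict hmod).alternates (hsub R hne hmod) (x := ⟨x, hx⟩) (y := ⟨y, hy⟩) hadj hlt i
    unfold orient reorient at hor
    simp only [hx, hy, if_true] at hor
    split_ifs at hor with hi
    · have := halt y hy x hx hor.2 hor.1
      rw [if_pos hi] at this
      omega
    · have := halt x hx y hy hor.2 hor.1
      rw [if_neg hi] at this
      omega
  refine hmin (reorient G r (p 0) R c) ⟨hr', fun w hw hadj => ?_⟩ (Finset.card_lt_card ?_)
  · by_cases hzw : z ∈ R ∧ w ∈ R
    · unfold reorient
      rw [if_pos hzw.1, if_pos hzw.2]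
      exact ⟨hfirst w hw, hadj⟩
    · exact (hout z w hzw).2 (hrz w hw hadj)
  · obtain ⟨x, hx, y, hy, hxy, hyx⟩ := hR0.2.exists_bad (h.injective 0) hr hcard
    refine (Finset.ssubset_iff_of_subset ?_).2 ⟨(0, x, y), ?_, ?_⟩
    · rintro ⟨i, x, y⟩ ha
      simp only [bad, Finset.mem_filter, Finset.mem_product, Finset.mem_univ, and_true,
        Finset.mem_range] at ha ⊢
      obtain ⟨hi, hxy, hor⟩ := ha
      refine ⟨hi, hxy, ?_⟩
      by_cases hR' : x ∈ R ∧ y ∈ R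
      · exact absurd hxy (hin x hR'.1 y hR'.2 i hor)
      · unfold orient at hor ⊢
        split_ifs at hor ⊢ with hi
        · exact (hout y x fun h => hR' h.symm).1 hor
        · exact (hout x y hR').1 hor
    · simp only [bad, Finset.mem_filter, Finset.mem_product, Finset.mem_univ, and_true,
        Finset.mem_range]
      exact ⟨h.pos, hxy, by rwa [horient0]⟩
    · simp only [bad, Finset.mem_filter, not_and]
      exact fun _ hxy' hor => hin x hx y hy 0 hor hxy'

end UmbrellaFree

/-! ### Two consecutive differences force a domino -/

section Domino

variable {V : Type*} {G : SimpleGraph V} {p q : V → ℕ}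

/-- If a sweep does not reverse `u` and `v`, then some vertex was preferring `u`. -/
theorem IsSweep.exists_favors (hs : IsSweep G p q) {u v : V} (hp : p u < p v) (hq : q u < q v) :
    ∃ w, q w < q u ∧ Favors G q w u v := by
  have hsplit : ∃ x, q x < q u ∧ ¬ (G.Adj x u ↔ G.Adj x v) := by
    by_contra hc
    push Not at hc
    exact absurd (hs.2 u v hq hc) (by omega)
  obtain ⟨x, hxu, hx⟩ := hsplit
  obtain ⟨w, hwx, hw⟩ := hs.1 u v x hq hxu hx
  exact ⟨w, hwx.trans_lt hxu, hw⟩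

/-- A vertex that is adjacent to `v` only is preceded by one that favors the earlier vertex `u`. -/
theorem IsLexBFS.exists_favors_lt (hL : IsLexBFS G q) (hq : Function.Injective q) {u v x : V}
    (huv : q u < q v) (hxu : q x < q u) (hx : ¬ G.Adj x u) (hx' : G.Adj x v) :
    ∃ w, q w < q x ∧ Favors G q w u v := by
  obtain ⟨w, hwx, hw⟩ := hL u v x huv hxu fun h => hx (h.2 hx')
  exact ⟨w, lt_of_le_of_ne hwx fun h => hx (hq h ▸ hw.1), hw⟩

theorem domino_adj_iff (i j : Fin 6) : domino.Adj i j ↔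
    (i, j) ∈ ([(0, 1), (0, 2), (1, 3), (2, 3), (2, 4), (3, 5), (4, 5), (1, 0), (2, 0), (3, 1),
      (3, 2), (4, 2), (5, 3), (5, 4)] : List (Fin 6 × Fin 6)) := by
  rw [domino, SimpleGraph.fromEdgeSet_adj]
  simp only [Set.mem_insert_iff, Set.mem_singleton_iff]
  revert i j
  decide

theorem not_isDominoFree_of_adj {a b c d e f : V} (hab : G.Adj a b) (hac : G.Adj a c)
    (hbd : G.Adj b d) (hcd : G.Adj c d) (hce : G.Adj c e) (hdf : G.Adj d f) (hef : G.Adj e f)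
    (had : ¬ G.Adj a d) (hae : ¬ G.Adj a e) (haf : ¬ G.Adj a f) (hbc : ¬ G.Adj b c)
    (hbe : ¬ G.Adj b e) (hbf : ¬ G.Adj b f) (hcf : ¬ G.Adj c f) (hde : ¬ G.Adj d e) :
    ¬ IsDominoFree G := by
  intro h
  have hadj : ∀ i j, G.Adj (![a, b, c, d, e, f] i) (![a, b, c, d, e, f] j) ↔ domino.Adj i j := by
    intro i j
    rw [domino_adj_iff]
    fin_cases i <;> fin_cases j <;>
      simp [hab, hac, hbd, hcd, hce, hdf, hef, had, hae, haf, hbc, hbe, hbf, hcf, hde, hab.symm,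
        hac.symm, hbd.symm, hcd.symm, hce.symm, hdf.symm, hef.symm, G.adj_comm d a, G.adj_comm e a,
        G.adj_comm f a, G.adj_comm c b, G.adj_comm e b, G.adj_comm f b, G.adj_comm f c,
        G.adj_comm e d]
  -- no two vertices of the domino have the same neighbours
  have hinj : Function.Injective ![a, b, c, d, e, f] := by
    intro i j hij
    have h1 : ∀ k, domino.Adj i k ↔ domino.Adj j k := fun k => by
      rw [← hadj, ← hadj, hij]
    simp only [domino_adj_iff] at h1
    clear hij hadj
    revert i j
    decide
  exact h.false ⟨⟨_, hinj⟩, fun {i j} => hadj i j⟩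

/-- Let `a` and `b` be the vertices at the first position `m` where the orders `p 2` and `p 4`
differ, and let `p 0` agree with them before that position. The vertices `a` and `b` form a
four-cycle with the first vertex `c` that tells them apart in `p 3` and the first vertex `d` that
tells them apart in `p 1`. In the same way `c` and `d` form a four-cycle with vertices that tell
them apart in `p 1` and `p 3`, and the two four-cycles are a domino. -/
theorem IsSweepCycle.not_isDominoFree {p : ℕ → V → ℕ} {K m : ℕ} (h : IsSweepCycle G p K)
    (hu : ∀ j, IsUmbrellaFree G (p j)) (h02 : ∀ x, p 0 x < m ∨ p 2 x < m → p 0 x = p 2 x)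
    (h24 : ∀ x, p 2 x < m ∨ p 4 x < m → p 2 x = p 4 x) {a b : V} (ha : p 2 a = m) (hb : p 4 b = m)
    (hab : a ≠ b) : ¬ IsDominoFree G := by
  have hinj := h.injective
  have s0 : IsSweep G (p 0) (p 1) := h.sweep 0
  have s1 : IsSweep G (p 1) (p 2) := h.sweep 1
  have s2 : IsSweep G (p 2) (p 3) := h.sweep 2
  have s3 : IsSweep G (p 3) (p 4) := h.sweep 3
  have flip1 : ∀ {u v : V}, ¬ G.Adj u v → p 1 u < p 1 v → p 2 v < p 2 u :=
    fun huv hlt => (hu 1).sweep_reverses (hinj 1) (hinj 2) s1 huv hlt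
  have flip2 : ∀ {u v : V}, ¬ G.Adj u v → p 2 u < p 2 v → p 3 v < p 3 u :=
    fun huv hlt => (hu 2).sweep_reverses (hinj 2) (hinj 3) s2 huv hlt
  have unflip1 : ∀ {u v : V}, ¬ G.Adj u v → p 2 u < p 2 v → p 1 v < p 1 u := by
    intro u v huv hlt
    by_contra hc
    rcases (not_lt.1 hc).lt_or_eq with h' | h'
    · exact absurd (flip1 huv h') (by omega)
    · exact absurd hlt (hinj 1 h' ▸ lt_irrefl _)
  have unflip2 : ∀ {u v : V}, ¬ G.Adj u v → p 3 u < p 3 v → p 2 v < p 2 u := by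
    intro u v huv hlt
    by_contra hc
    rcases (not_lt.1 hc).lt_or_eq with h' | h'
    · exact absurd (flip2 huv h') (by omega)
    · exact absurd hlt (hinj 2 h' ▸ lt_irrefl _)
  have hab2 : p 2 a < p 2 b := by
    have h1 : ¬ p 2 b < m := fun h1 => by
      have := h24 b (Or.inl h1)
      omega
    have h2 : p 2 b ≠ m := fun h2 => hab (hinj 2 (ha.trans h2.symm))
    omega
  have hba4 : p 4 b < p 4 a := by
    have h1 : ¬ p 4 a < m := fun h1 => by
      have := h24 a (Or.inr h1)
      omega
    have h2 : p 4 a ≠ m := fun h2 => hab (hinj 4 (h2.trans hb.symm))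
    omega
  -- the common beginning of the two orders does not tell `a` and `b` apart
  have htied : ∀ x, p 2 x < m → (G.Adj x a ↔ G.Adj x b) := by
    intro x hx
    by_contra hc
    obtain ⟨w, hwx, hw⟩ := (h.isLexBFS 2) a b x hab2 (by omega) hc
    have hx4 := h24 x (Or.inl hx)
    have hw4 := h24 w (Or.inl (by omega))
    obtain ⟨w', hw', hw'f⟩ := (h.isLexBFS 4).exists_favors_lt (hinj 4) hba4
      (show p 4 w < p 4 b by omega) hw.2.1 hw.1
    have hw'4 := h24 w' (Or.inr (by omega))
    exact hw'f.2.1 ((hw.2.2 w' (by omega)).2 hw'f.1)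
  have hba1 : p 1 b < p 1 a := s1.2 a b hab2 fun x hx => htied x (by omega)
  have hab3 : p 3 a < p 3 b := s3.2 b a hba4 fun x hx =>
    (htied x (by have := h24 x (Or.inr (by omega)); omega)).symm
  have hadj : G.Adj a b := by
    by_contra hc
    have h1 := flip1 (fun h => hc h.symm) hba1
    have h2 := flip2 hc h1
    omega
  obtain ⟨c, hca3, hca, hcb, hc⟩ := s2.exists_favors hab2 hab3
  have hbc2 : p 2 b < p 2 c := unflip2 hcb (by omega)
  have hcb1 : p 1 c < p 1 b := unflip1 (fun h => hcb h.symm) hbc2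
  obtain ⟨d, hdc1, hdb, hda, hd⟩ := (h.isLexBFS 1).exists_favors_lt (hinj 1) hba1 hcb1 hcb hca
  have hdc : G.Adj d c := by
    by_contra hdc
    exact hu 1 d c b hdc1 hcb1 hdc hcb hdb
  have had2 : p 2 a < p 2 d := flip1 hda (by omega)
  have hda3 : p 3 d < p 3 a := flip2 (fun h => hda h.symm) had2
  have hcd3 : p 3 c < p 3 d := by
    by_contra hlt
    rcases (not_lt.1 hlt).lt_or_eq with h' | h'
    · exact hda ((hc d h').2 hdb)
    · exact hda (hinj 3 h' ▸ hca)
  -- `e` and `f` tell `c` and `d` apart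
  obtain ⟨e, f, hec, hed, hfd, hfc, hef, hea, heb, hfa, hfb⟩ : ∃ e f, G.Adj e c ∧ ¬ G.Adj e d ∧
      G.Adj f d ∧ ¬ G.Adj f c ∧ G.Adj e f ∧ ¬ G.Adj e a ∧ ¬ G.Adj e b ∧ ¬ G.Adj f a ∧
      ¬ G.Adj f b := by
    rcases lt_trichotomy (p 2 c) (p 2 d) with hcd2 | hcd2 | hcd2
    · obtain ⟨e, hec3, hec, hed, -⟩ := s2.exists_favors hcd2 hcd3
      have hed1 : p 1 e < p 1 d := unflip1 (fun h => hed h.symm) (unflip2 hed (by omega))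
      obtain ⟨f, hfe1, hfd, hfc, -⟩ := (h.isLexBFS 1).exists_favors_lt (hinj 1) hdc1 hed1 hed hec
      have hfe : G.Adj f e := by
        by_contra hfe
        exact hu 1 f e d hfe1 hed1 hfe hed hfd
      have hea := hu 1 e d a hed1 (by omega) hed hda
      have hfb := hu 1 f c b (by omega) (by omega) hfc hcb
      exact ⟨e, f, hec, hed, hfd, hfc, hfe.symm, hea, fun h => hea ((hc e hec3).2 h),
        fun h => hfb ((hd f (by omega)).2 h), hfb⟩
    · rw [hinj 2 hcd2] at hcd3
      omega
    · -- a vertex before `a` prefers `d` to `c`, so `d` precedes `c` in `p 0` as well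
      obtain ⟨e', he'a, he'd, he'c, he'⟩ := (h.isLexBFS 2).exists_favors_lt (hinj 2) hcd2 had2
        (fun h => hda h.symm) hca.symm
      have hdc0 : p 0 d < p 0 c := by
        by_contra hlt
        have hcd0 : p 0 c < p 0 d := lt_of_le_of_ne (not_lt.1 hlt) fun h' => by
          rw [hinj 0 h'] at hcd2
          omega
        have he'0 := h02 e' (Or.inr (by omega))
        have hc0 : ¬ p 0 c < m := fun h' => by
          have := h02 c (Or.inl h')
          omega
        obtain ⟨g, hg, hgc, hgd, -⟩ := (h.isLexBFS 0).exists_favors_lt (hinj 0) hcd0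
          (show p 0 e' < p 0 c by omega) he'c he'd
        have hg0 := h02 g (Or.inl (by omega))
        exact hgd ((he' g (by omega)).2 hgc)
      obtain ⟨f, hfd1, hfd, hfc, -⟩ := s0.exists_favors hdc0 hdc1
      have hfb := hu 1 f c b (by omega) hcb1 hfc hcb
      have hfc3 : p 3 f < p 3 c := flip2 (fun h => hfc h.symm) (flip1 hfc (by omega))
      obtain ⟨e, hef3, hec, hed, -⟩ := (h.isLexBFS 3).exists_favors_lt (hinj 3) hcd3 hfc3 hfc hfd
      have hef : G.Adj e f := by
        by_contra hef
        exact hu 3 e f c hef3 hfc3 hef hfc hec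
      have hea := hu 3 e d a (by omega) hda3 hed hda
      exact ⟨e, f, hec, hed, hfd, hfc, hef, hea, fun h => hea ((hc e (by omega)).2 h),
        fun h => hfb ((hd f hfd1).2 h), hfb⟩
  exact not_isDominoFree_of_adj hadj hca.symm hdb.symm hdc.symm hec.symm hfd.symm hef
    (fun h => hda h.symm) (fun h => hea h.symm) (fun h => hfa h.symm) (fun h => hcb h.symm)
    (fun h => heb h.symm) (fun h => hfb h.symm) (fun h => hfc h.symm) (fun h => hed h.symm)

end Domino

/-! ### Cycles of sweeps have length two -/

section Cycles

variable {V : Type*} [Fintype V] [DecidableEq V] {G : SimpleGraph V} [DecidableRel G.Adj]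

theorem IsCocomparability.exists_isOrientation {V : Type*} {G : SimpleGraph V}
    (h : IsCocomparability G) : ∃ r, IsOrientation G r := by
  obtain ⟨r, hr, h⟩ := h
  refine ⟨r, hr.irrefl, hr.trans, fun x y hxy hadj => ?_, fun x y hxy => ?_⟩
  · exact (h x y).1 ((G.compl_adj x y).2 ⟨hxy, hadj⟩)
  · exact ((G.compl_adj x y).1 ((h x y).2 (Or.inl hxy))).2

/-- The iterated sweeps of a periodic order, started at the `i`-th one. -/
theorem isSweepCycle_iterate {k : ℕ} (hk : 0 < k) {σ : VertexOrdering V}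
    (hσ : Function.IsPeriodicPt (lexBFSPlus G) k σ) (i : ℕ) :
    IsSweepCycle G (fun j v => ((lexBFSPlus G)^[i + j] σ v : ℕ)) k where
  pos := hk
  injective j := Fin.val_injective.comp (Equiv.injective _)
  sweep j := by
    simp only [← add_assoc, Function.iterate_succ_apply']
    exact isSweep_lexBFSPlus G _
  period j := by
    simp only [← add_assoc, Function.iterate_add_apply _ _ k, hσ.eq]

/-- If some periodic sequence of sweeps did not repeat after two steps, then the first position `m`
at which an order of it differs from the order two steps later could be chosen as small as possible.
The orders two steps apart then all agree before `m`, and the two differing vertices give a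
domino. -/
theorem isPeriodicPt_two (hG : IsCocomparability G) (hdomino : IsDominoFree G)
    {σ : VertexOrdering V} (hσ : σ ∈ Function.periodicPts (lexBFSPlus G)) :
    Function.IsPeriodicPt (lexBFSPlus G) 2 σ := by
  classical
  obtain ⟨k, hk, hkσ⟩ := hσ
  set s : ℕ → VertexOrdering V := fun j => (lexBFSPlus G)^[j] σ with hs
  have hsk : ∀ j, s (j + 2 * k) = s j := fun j => by
    simp only [hs, Function.iterate_add_apply _ _ (2 * k), (hkσ.const_mul 2).eq]
  by_contra hne
  -- `Nat.find hex` is the smallest position of a difference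
  have hex : ∃ m, ∃ j x, (s j x : ℕ) = m ∧ (s (j + 2) x : ℕ) ≠ m := by
    by_contra hc
    push Not at hc
    exact hne (Equiv.ext fun x => Fin.ext (hc _ 0 x rfl))
  obtain ⟨j, a, ha, ha'⟩ := Nat.find_spec hex
  have hmin : ∀ i x, (s i x : ℕ) < Nat.find hex → (s (i + 2) x : ℕ) = s i x := by
    intro i x hx
    by_contra hc
    exact Nat.find_min hex hx ⟨i, x, rfl, hc⟩
  -- the orders number `i` and `i + 2` are bijections, so they have the same first vertices
  have hmin' : ∀ i x, (s i x : ℕ) < Nat.find hex ∨ (s (i + 2) x : ℕ) < Nat.find hex →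
      (s i x : ℕ) = s (i + 2) x := by
    rintro i x (hx | hx)
    · exact (hmin i x hx).symm
    · have hy : s i ((s i).symm (s (i + 2) x)) = s (i + 2) x := Equiv.apply_symm_apply _ _
      have h1 := hmin i ((s i).symm (s (i + 2) x)) (by rw [hy]; exact hx)
      rw [hy] at h1
      rw [(s (i + 2)).injective (Fin.ext h1)] at hy
      rw [hy]
  -- shift the cycle so that the difference is between its orders number `2` and `4`
  have hcyc := isSweepCycle_iterate hk hkσ (j + (2 * k - 2))
  have e2 : s (j + (2 * k - 2) + 2) = s j := by
    rw [show j + (2 * k - 2) + 2 = j + 2 * k by omega, hsk]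
  have e4 : s (j + (2 * k - 2) + 4) = s (j + 2) := by
    rw [show j + (2 * k - 2) + 4 = j + 2 + 2 * k by omega, hsk]
  refine hcyc.not_isDominoFree (m := Nat.find hex) (a := a) (b := (s (j + 2)).symm (s j a))
    (hcyc.isUmbrellaFree hG.exists_isOrientation)
    (fun x => hmin' (j + (2 * k - 2)) x) (fun x => hmin' (j + (2 * k - 2) + 2) x) ?_ ?_ ?_ hdomino
  · exact (congrArg (fun τ : VertexOrdering V => (τ a : ℕ)) e2).trans ha
  · refine (congrArg (fun τ : VertexOrdering V => (τ ((s (j + 2)).symm (s j a)) : ℕ)) e4).trans ?_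
    simpa using ha
  · intro hab
    apply ha'
    rw [hab, Equiv.apply_symm_apply]
    exact ha

/-- No order is its own sweep, because a sweep begins with the last vertex of the order it started
from. -/
theorem lexBFSPlus_ne [Nontrivial V] (σ : VertexOrdering V) : lexBFSPlus G σ ≠ σ := by
  intro h
  obtain ⟨z, w, hlt⟩ : ∃ z w, z ≠ w ∧ ∀ x, ¬ (lexBFSPlus G σ x : ℕ) < lexBFSPlus G σ z := by
    have hc : 0 < Fintype.card V := Fintype.card_pos
    obtain ⟨w, hw⟩ := exists_ne ((lexBFSPlus G σ).symm ⟨0, hc⟩)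
    exact ⟨_, w, hw.symm, by simp⟩
  have hzw : (lexBFSPlus G σ z : ℕ) < lexBFSPlus G σ w :=
    lt_of_le_of_ne (not_lt.1 (hlt.2 w)) fun he =>
      hlt.1 ((lexBFSPlus G σ).injective (Fin.ext he))
  have hwz : (σ w : ℕ) < σ z :=
    (isSweep_lexBFSPlus G σ).2 z w hzw fun x hx => absurd hx (hlt.2 x)
  rw [h] at hzw
  omega

/-- There are finitely many orders, so the iterated sweeps of any of them become periodic. -/
theorem cycleLengths_nonempty : (cycleLengths G).Nonempty := by
  obtain ⟨i, j, hij, h⟩ := Finite.exists_ne_map_eq_of_infinite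
    fun i : ℕ => (lexBFSPlus G)^[i] (Fintype.equivFin V)
  wlog hlt : i < j generalizing i j
  · exact this j i hij.symm h.symm (by omega)
  refine ⟨_, (lexBFSPlus G)^[i] (Fintype.equivFin V), ⟨j - i, by omega, ?_⟩, rfl⟩
  rw [Function.IsPeriodicPt, Function.IsFixedPt, ← Function.iterate_add_apply,
    Nat.sub_add_cancel hlt.le]
  exact h.symm

theorem eq_two_of_mem_cycleLengths [Nontrivial V] (hG : IsCocomparability G)
    (hdomino : IsDominoFree G) {k : ℕ} (hk : k ∈ cycleLengths G) : k = 2 := by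
  obtain ⟨σ, hσ, rfl⟩ := hk
  rcases (Nat.dvd_prime Nat.prime_two).1 (isPeriodicPt_two hG hdomino hσ).minimalPeriod_dvd
    with h | h
  · exact absurd (Function.minimalPeriod_eq_one_iff_isFixedPt.1 h) (lexBFSPlus_ne σ)
  · exact h

end Cycles

end LexBFSCycle

theorem mainTheorem1 {V : Type*} [Fintype V] [DecidableEq V] [Nontrivial V]
    (G : SimpleGraph V) [DecidableRel G.Adj]
    (hcocomp : LexBFSCycle.IsCocomparability G) (hdomino : LexBFSCycle.IsDominoFree G) :
    (∀ k ∈ LexBFSCycle.cycleLengths G, k = 2) ∧ LexBFSCycle.lexCycle G = 2 := by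
  have h : ∀ k ∈ LexBFSCycle.cycleLengths G, k = 2 := fun k hk =>
    LexBFSCycle.eq_two_of_mem_cycleLengths hcocomp hdomino hk
  refine ⟨h, ?_⟩
  rw [LexBFSCycle.lexCycle,
    LexBFSCycle.cycleLengths_nonempty.subset_singleton_iff.1 h, csSup_singleton]
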